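/- **Setting.** Let $(V,E)$ be a finite directed graph. A distributed system $G$ over it has temporal states $x^{(k)}(t)\in\mathbb R^{n^{(k)}(t)}$ ($k\in V$), spatial states $x^{(ij)}(t)\in\mathbb R^{n^{(ij)}(t)}$ ($(i,j)\in E$), inputs $u^{(k)}(t)$ and outputs $y^{(k)}(t)$, where all dimensions may depend on $t\in\mathbb N_0$. With zero initial states, $$\begin{bmatrix}x^{(k)}(t+1)\\ x^{(k)}_{\rm out}(t+1)\end{bmatrix}=A^{(k)}(t)\begin{bmatrix}x^{(k)}(t)\\ x^{(k)}_{\rm in}(t)\end{bmatrix}+B^{(k)}(t)u^{(k)}(t),\qquad y^{(k)}(t)=C^{(k)}(t)\begin{bmatrix}x^{(k)}(t)\\ x^{(k)}_{\rm in}(t)\end{bmatrix}+D^{(k)}(t)u^{(k)}(t),$$ where $x^{(k)}_{\rm in}$ stacks the $x^{(ik)}$ with $(i,k)\in E$ and $x^{(k)}_{\rm out}$ stacks the $x^{(kj)}$ with $(k,j)\in E$. For families of symmetric matrices $X^{(k)}(t),X^{(ij)}(t)$ of sizes $n^{(k)}(t),n^{(ij)}(t)$, put $X^{\rm in}_k(t)=\mathrm{diag}(X^{(k)}(t),(X^{(ik)}(t))_{(i,k)\in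 E})$ and $X^{\rm out}_k(t)=\mathrm{diag}(X^{(k)}(t),(X^{(kj)}(t))_{(k,j)\in E})$. Call the family admissible for $\beta>0$ if it is uniformly bounded and all its matrices are $\succ\beta I$. * $G$ is *strongly stable* if for some $\beta>0$ and some admissible $X$, $A^{(k)}(t)^TX^{\rm out}_k(t+1)A^{(k)}(t)-X^{\rm in}_k(t)\prec-\beta I$ for all $t,k$. * A realization is *balanced*, with balanced generalized gramians $\Sigma$, if for some $\beta>0$ the family $\Sigma$ is admissible, consists of diagonal matrices, and for all $t,k$ satisfies $A^{(k)}\Sigma^{\rm in}_k(t)A^{(k)T}-\Sigma^{\rm out}_k(t+1)+B^{(k)}B^{(k)T}\prec-\beta I$ and $A^{(k)T}\Sigma^{\rm out}_k(t+1)A^{(k)}-\Sigma^{\rm in}_k(t)+C^{(k)T}C^{(k)}\prec-\beta I$, where $A^{(k)},B^{(k)},C^{(k)}$ are taken at $t$. * For integers $h\ge0$, $q>0$, a sequence $f$ is *$(h,q)$-eventually time-periodic (ETP)* if $f(t+h+zq)=f(t+h)$ for all $t,z\in\mathbb N_0$. A system is $(h,q)$-ETP if its state-space matrices are, dimensions included,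 and likewise for families of matrices. * $\|w\|_2=(\sum_{t,k}|w^{(k)}(t)|^2)^{1/2}$, and the norm of a map $F$ from inputs to outputs is $\|F\|=\sup_{0\ne u\in\ell_2}\|Fu\|_2/\|u\|_2$. $\zeta(M)$ is the sum of the *distinct* diagonal entries of $M$. **Statement.** Let $G$ be a strongly stable $(h,q)$-ETP system. 1. There are $(h,q)$-ETP invertible matrices $T^{(k)}(t),T^{(ij)}(t)$ such that the realization of $G$ obtained by the change of state coordinates $x^{(k)}\mapsto T^{(k)}x^{(k)}$, $x^{(ij)}\mapsto T^{(ij)}x^{(ij)}$ (which has the same input-output map) is $(h,q)$-ETP and balanced with $(h,q)$-ETP balanced generalized gramians $\Sigma_{\rm eper}$, whose diagonal entries in each $\Sigma^{(k)}_{\rm eper}(t)$, $\Sigma^{(ij)}_{\rm eper}(t)$ may be taken in decreasing order. 2. Consider any $(h,q)$-ETP balanced realization over $(V,E)$ with the same input-output map as $G$, with $(h,q)$-ETP balanced generalized gramians $\Sigma_{\rm eper}$, and any $(h,q)$-ETP integers $0\le r^{(k)}(t)\le n^{(k)}(t)$, $0\le r^{(ij)}(t)\le n^{(ij)}(t)$.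 Partition $\Sigma^{(k)}_{\rm eper}=\mathrm{diag}(\Gamma^{(k)}_{\rm eper},\Omega^{(k)}_{\rm eper})$ and $\Sigma^{(ij)}_{\rm eper}=\mathrm{diag}(\Gamma^{(ij)}_{\rm eper},\Omega^{(ij)}_{\rm eper})$, with $\Gamma$-blocks of sizes $r^{(k)}(t)$ and $r^{(ij)}(t)$, and let $G_r$ be the balanced truncation, obtained by keeping in each state only the leading $r^{(k)}(t)$, respectively $r^{(ij)}(t)$, variables. Then $G_r$ is strongly stable, and its realization is $(h,q)$-ETP and balanced with the $(h,q)$-ETP balanced generalized gramians $\Gamma_{\rm eper}$. If at least one state variable is truncated at some time, then $$\|G-G_r\|<2\,\zeta(\Omega_{\rm eper}),$$ where $\Omega_{\rm eper}$ is the finite block-diagonal matrix formed by all $\Omega^{(k)}_{\rm eper}(t)$, $k\in V$, and $\Omega^{(ij)}_{\rm eper}(t)$, $(i,j)\in E$, for $t\in\{0,1,\dots,h+q-1\}$. -/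

import Mathlib

open scoped ENNReal Matrix

namespace DistSys

section Graph

variable {V : Type*} [DecidableEq V] (E : Finset (V × V))

/-- The state slots of a system over the directed graph `(V, E)`: `Sum.inl k` stands for the temporal
state of vertex `k`, and `Sum.inr e` for the spatial state of the directed edge `e`. -/
abbrev Slot : Type _ := V ⊕ E

variable {E}

/-- The vertex whose subsystem reads the slot: `k` for `x^(k)`, and `j` for `x^(ij)`. -/
def Slot.head : Slot E → V
  | Sum.inl k => k
  | Sum.inr e => e.1.2

/-- The vertex whose subsystem writes the slot: `k` for `x^(k)`, and `i` for `x^(ij)`. -/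
def Slot.tail : Slot E → V
  | Sum.inl k => k
  | Sum.inr e => e.1.1

variable (E)

/-- The slots that make up the vector `[x^(k); x_in^(k)]`. -/
abbrev InSlot (k : V) : Type _ := {s : Slot E // s.head = k}

/-- The slots that make up the vector `[x^(k); x_out^(k)]`. -/
abbrev OutSlot (k : V) : Type _ := {s : Slot E // s.tail = k}

variable {E}

/-- Coordinates of `[x^(k); x_in^(k)]` when the slot `s` has dimension `d s`. -/
abbrev InIdx (d : Slot E → ℕ) (k : V) : Type _ := Σ s : InSlot E k, Fin (d s.1)

/-- Coordinates of `[x^(k); x_out^(k)]` when the slot `s` has dimension `d s`. -/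
abbrev OutIdx (d : Slot E → ℕ) (k : V) : Type _ := Σ s : OutSlot E k, Fin (d s.1)

/-- `diag(X^(k), X_in^(k))`. -/
abbrev diagIn {d : Slot E → ℕ} (X : ∀ s, Matrix (Fin (d s)) (Fin (d s)) ℝ) (k : V) :
    Matrix (InIdx d k) (InIdx d k) ℝ :=
  Matrix.blockDiagonal' fun s : InSlot E k => X s.1

/-- `diag(X^(k), X_out^(k))`. -/
abbrev diagOut {d : Slot E → ℕ} (X : ∀ s, Matrix (Fin (d s)) (Fin (d s)) ℝ) (k : V) :
    Matrix (OutIdx d k) (OutIdx d k) ℝ :=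
  Matrix.blockDiagonal' fun s : OutSlot E k => X s.1

end Graph

/-- The sequence `f` is `(h,q)`-eventually time-periodic. -/
def IsETP {α : Type*} (h q : ℕ) (f : ℕ → α) : Prop :=
  ∀ t z : ℕ, f (t + h + z * q) = f (t + h)

/-- `M ≺ N`: the difference `N - M` is symmetric and positive definite. -/
def SLt {ι : Type*} [Fintype ι] (M N : Matrix ι ι ℝ) : Prop := (N - M).PosDef

section Signals

variable {V : Type*}

/-- Signals `w^(k)(t) ∈ ℝ^(d^(k)(t))`. -/
abbrev Signal (d : ℕ → V → ℕ) : Type _ := ∀ t k, Fin (d t k) → ℝ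

/-- The `ℓ₂`-norm of a signal, with value `∞` when the signal is not in `ℓ₂`. -/
noncomputable def l2norm [Fintype V] {d : ℕ → V → ℕ} (w : Signal d) : ℝ≥0∞ :=
  (∑' t, ∑ k, ∑ i, ENNReal.ofReal (w t k i ^ 2)) ^ (1 / 2 : ℝ)

/-- The `ℓ₂`-induced norm `sup_{0 ≠ u ∈ ℓ₂} ‖F u‖₂ / ‖u‖₂`. -/
noncomputable def inducedNorm [Fintype V] {nu ny : ℕ → V → ℕ} (F : Signal nu → Signal ny) : ℝ≥0∞ :=
  ⨆ (u : Signal nu) (_ : u ≠ 0) (_ : l2norm u ≠ ∞), l2norm (F u) / l2norm u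

end Signals

/-- The sum of the distinct diagonal entries of a square matrix. -/
noncomputable def zeta {ι : Type*} [Fintype ι] (M : Matrix ι ι ℝ) : ℝ :=
  ∑ x ∈ Finset.univ.image (fun i => M i i), x

section Systems

variable {V : Type*} [Fintype V] [DecidableEq V] {E : Finset (V × V)}

/-- A family of square matrices `X^(k)(t)`, `X^(ij)(t)`, conformable with the dimensions `n`. -/
abbrev Family (n : ℕ → Slot E → ℕ) : Type _ := ∀ t s, Matrix (Fin (n t s)) (Fin (n t s)) ℝ

/-- The family (together with its dimensions) is `(h,q)`-ETP. -/
def Family.IsETP {n : ℕ → Slot E → ℕ} (X : Family n) (h q : ℕ) : Prop :=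
  DistSys.IsETP h q fun t =>
    (⟨n t, X t⟩ : Σ d : Slot E → ℕ, ∀ s, Matrix (Fin (d s)) (Fin (d s)) ℝ)

/-- The matrices `X^(k)(t)`, `X^(ij)(t)` are symmetric, uniformly bounded, and `≻ β I`. -/
def Family.UniformlyPosDef {n : ℕ → Slot E → ℕ} (X : Family n) (β : ℝ) : Prop :=
  (∀ t s, SLt (β • 1) (X t s)) ∧ ∃ c : ℝ, ∀ t s, SLt (X t s) (c • 1)

variable (E) in
/-- A realization `(A^(k)(t), B^(k)(t), C^(k)(t), D^(k)(t))` of a distributed system over the directed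
graph `(V, E)`, with input dimensions `nu` and output dimensions `ny`. The blocks of the matrices
are indexed by the slots. -/
structure Sys (nu ny : ℕ → V → ℕ) where
  /-- dimensions of the temporal and the spatial states -/
  n : ℕ → Slot E → ℕ
  A : ∀ t k, Matrix (OutIdx (n (t + 1)) k) (InIdx (n t) k) ℝ
  B : ∀ t k, Matrix (OutIdx (n (t + 1)) k) (Fin (nu t k)) ℝ
  C : ∀ t k, Matrix (Fin (ny t k)) (InIdx (n t) k) ℝ
  D : ∀ t k, Matrix (Fin (ny t k)) (Fin (nu t k)) ℝ

namespace Sys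

variable {nu ny : ℕ → V → ℕ} (G : Sys E nu ny)

/-- The state response to the input `u` from zero initial conditions, i.e. the unique solution of
`[x^(k)(t+1); x_out^(k)(t+1)] = A^(k)(t) [x^(k)(t); x_in^(k)(t)] + B^(k)(t) u^(k)(t)`. -/
def state (u : Signal nu) : ∀ t s, Fin (G.n t s) → ℝ
  | 0 => 0
  | t + 1 => fun s i =>
      (G.A t s.tail *ᵥ (fun p => state u t p.1.1 p.2) + G.B t s.tail *ᵥ u t s.tail) ⟨⟨s, rfl⟩, i⟩

/-- The input-output map
`y^(k)(t) = C^(k)(t) [x^(k)(t); x_in^(k)(t)] + D^(k)(t) u^(k)(t)`. -/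
def output (u : Signal nu) : Signal ny := fun t k =>
  G.C t k *ᵥ (fun p => G.state u t p.1.1 p.2) + G.D t k *ᵥ u t k

/-- All state-space matrices (together with their dimensions) are `(h,q)`-ETP. -/
def IsETP (h q : ℕ) : Prop :=
  DistSys.IsETP h q fun t =>
    (⟨(G.n (t + 1), G.n t, nu t, ny t), (G.A t, G.B t, G.C t, G.D t)⟩ :
      Σ d : (Slot E → ℕ) × (Slot E → ℕ) × (V → ℕ) × (V → ℕ),
        (∀ k, Matrix (OutIdx d.1 k) (InIdx d.2.1 k) ℝ) ×
        (∀ k, Matrix (OutIdx d.1 k) (Fin (d.2.2.1 k)) ℝ) ×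
        (∀ k, Matrix (Fin (d.2.2.2 k)) (InIdx d.2.1 k) ℝ) ×
        (∀ k, Matrix (Fin (d.2.2.2 k)) (Fin (d.2.2.1 k)) ℝ))

/-- Strong stability: the structured Lyapunov inequalities have a solution. -/
def StronglyStable : Prop :=
  ∃ β : ℝ, 0 < β ∧ ∃ X : Family G.n, X.UniformlyPosDef β ∧ ∀ t k,
    SLt ((G.A t k)ᵀ * diagOut (X (t + 1)) k * G.A t k - diagIn (X t) k) (-(β • 1))

/-- The generalized Lyapunov inequalities for controllability. -/
def CtrlLyapunov (β : ℝ) (X : Family G.n) : Prop :=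
  ∀ t k, SLt (G.A t k * diagIn (X t) k * (G.A t k)ᵀ - diagOut (X (t + 1)) k
    + G.B t k * (G.B t k)ᵀ) (-(β • 1))

/-- The generalized Lyapunov inequalities for observability. -/
def ObsvLyapunov (β : ℝ) (Y : Family G.n) : Prop :=
  ∀ t k, SLt ((G.A t k)ᵀ * diagOut (Y (t + 1)) k * G.A t k - diagIn (Y t) k
    + (G.C t k)ᵀ * G.C t k) (-(β • 1))

/-- `S` consists of balanced generalized gramians of the realization `G`. The realization is
balanced if such a family exists. -/
def IsBalancedBy (S : Family G.n) : Prop :=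
  (∀ t s, (S t s).IsDiag) ∧
    ∃ β : ℝ, 0 < β ∧ S.UniformlyPosDef β ∧ G.CtrlLyapunov β S ∧ G.ObsvLyapunov β S

/-- The realization `(T_pre(t+1) A T_post(t), T_pre(t+1) B, C T_post(t), D)` obtained by changing the
coordinates of each temporal and spatial state with the (invertible) matrices `T`. -/
noncomputable def transform (T : Family G.n) : Sys E nu ny where
  n := G.n
  A t k := diagOut (T (t + 1)) k * G.A t k * diagIn (fun s => (T t s)⁻¹) k
  B t k := diagOut (T (t + 1)) k * G.B t k
  C t k := G.C t k * diagIn (fun s => (T t s)⁻¹) k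
  D := G.D

/-- The reduced-order system: in the state with slot `s` only the first `r t s` variables are kept
at time `t`. -/
def truncate (r : ℕ → Slot E → ℕ) (hr : ∀ t s, r t s ≤ G.n t s) : Sys E nu ny where
  n := r
  A t k := (G.A t k).submatrix (fun p => ⟨p.1, Fin.castLE (hr (t + 1) p.1.1) p.2⟩)
    (fun p => ⟨p.1, Fin.castLE (hr t p.1.1) p.2⟩)
  B t k := (G.B t k).submatrix (fun p => ⟨p.1, Fin.castLE (hr (t + 1) p.1.1) p.2⟩) id
  C t k := (G.C t k).submatrix id (fun p => ⟨p.1, Fin.castLE (hr t p.1.1) p.2⟩)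
  D := G.D

end Sys

/-- The blocks `Γ` in `S = diag(Γ, Ω)`: the leading `r × r` blocks. -/
def Family.kept {n : ℕ → Slot E → ℕ} (S : Family n) (r : ℕ → Slot E → ℕ)
    (hr : ∀ t s, r t s ≤ n t s) : Family r := fun t s =>
  (S t s).submatrix (Fin.castLE (hr t s)) (Fin.castLE (hr t s))

/-- The blocks `Ω` in `S = diag(Γ, Ω)`: the trailing `(n - r) × (n - r)` blocks. -/
def Family.cut {n : ℕ → Slot E → ℕ} (S : Family n) (r : ℕ → Slot E → ℕ) :
    Family (fun t s => n t s - r t s) := fun t s =>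
  (S t s).submatrix (fun i : Fin (n t s - r t s) => ⟨r t s + i, by omega⟩)
    (fun i : Fin (n t s - r t s) => ⟨r t s + i, by omega⟩)

/-- The block-diagonal matrix formed by all the matrices `W^(k)(t)`, `W^(ij)(t)` with
`t ∈ {0, …, m - 1}`. -/
def Family.diagUpTo {n : ℕ → Slot E → ℕ} (W : Family n) (m : ℕ) :
    Matrix (Σ t : Fin m, Σ s, Fin (n t s)) (Σ t : Fin m, Σ s, Fin (n t s)) ℝ :=
  Matrix.blockDiagonal' fun t : Fin m => Matrix.blockDiagonal' fun s => W t s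

end Systems

end DistSys

namespace DistSys

/-! ### Quadratic-form consequences of the Lyapunov inequalities, and regrouping over slots. -/

section

section Matrices

variable {ι κ μ : Type*} [Fintype ι] [Fintype κ] [Fintype μ]

/-! Existence. Let `X` be any bounded solution of the strong stability inequalities. For times past
`h`, adding the values of `X` at `N` successive periods gives a family that is periodic by
construction. The Lyapunov inequalities add up and the sums match from one time to the next, except
where a period wraps around: there one boundary term, bounded independently of `N`, is wrong, and
the accumulated margin `N β` absorbs it for large `N`. On the initial segment a large multiple of
`X` is used, so that it dominates the sum at the junction (`Sys.IsETP.exists_lyapunov`). Writing the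
periodic solution as `TᵀT` and changing coordinates by `T` turns every `A` into a uniform strict
contraction, and so is `Aᵀ`. A large multiple of the identity then satisfies both gramian
inequalities, since `B` and `C` take finitely many values; its diagonal is constant, hence ordered.

Truncation. The inequalities pass to principal subsystems, because the discarded columns contribute
a positive semidefinite term. For the error, truncating is the same as resetting the truncated
variables to zero at every step, so all intermediate systems live in the full state space and obey
the original inequalities. Let `x`, `x'` be two such responses, `x'` resetting in addition variables
with one common gramian value `σ`. Observability applied to `x - x'`, and controllability in its
dual form for the inverse gramian applied to `x + x'` (driven by `2u`), make `∑ S (x - x')² + σ² ∑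
S⁻¹ (x + x')²` a storage function with supply rate `(1 - δ)(2σ)²|u|² - |y - y'|²`. Resetting does
not increase it, since in the new coordinates both weights equal `σ`. The distinct values can
therefore be removed one at a time, in any order, and the triangle inequality adds up the terms `2σ`
(`Sys.sum_maskedOutput_sub_sq_le`, `Sys.sum_output_sub_maskedOutput_sq_le`). Periodicity makes the
set of values finite, and the uniform margin `β` supplies `δ > 0`, which makes the bound strict. -/

theorem SLt.dotProduct_le {M N : Matrix ι ι ℝ} (h : SLt M N) (v : ι → ℝ) :
    v ⬝ᵥ (M *ᵥ v) ≤ v ⬝ᵥ (N *ᵥ v) := by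
  have := h.posSemidef.dotProduct_mulVec_nonneg v
  simp only [star_trivial, Matrix.sub_mulVec, dotProduct_sub] at this
  linarith

theorem dotProduct_diagonal_mulVec [DecidableEq ι] (d v : ι → ℝ) :
    v ⬝ᵥ (Matrix.diagonal d *ᵥ v) = ∑ i, d i * v i ^ 2 := by
  simp only [dotProduct, Matrix.mulVec_diagonal]
  exact Finset.sum_congr rfl fun i _ => by ring

theorem dotProduct_transpose_mul_mulVec (A : Matrix κ ι ℝ) (v : ι → ℝ) :
    v ⬝ᵥ ((Aᵀ * A) *ᵥ v) = ∑ j, (A *ᵥ v) j ^ 2 := by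
  rw [← Matrix.mulVec_mulVec, Matrix.dotProduct_mulVec, Matrix.vecMul_transpose]
  simp only [dotProduct, sq]

theorem dotProduct_congruence_mulVec (A : Matrix κ ι ℝ) (X : Matrix κ κ ℝ) (v : ι → ℝ) :
    v ⬝ᵥ ((Aᵀ * X * A) *ᵥ v) = (A *ᵥ v) ⬝ᵥ (X *ᵥ (A *ᵥ v)) := by
  rw [← Matrix.mulVec_mulVec, ← Matrix.mulVec_mulVec, Matrix.dotProduct_mulVec,
    Matrix.vecMul_transpose]

/-- An observability Lyapunov inequality with diagonal solution is a dissipation inequality. -/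
theorem sum_sq_add_le_of_obsv [DecidableEq ι] [DecidableEq κ] {A : Matrix κ ι ℝ} {C : Matrix μ ι ℝ}
    {x : κ → ℝ} {y : ι → ℝ} {β : ℝ} (hβ : 0 ≤ β)
    (h : SLt (Aᵀ * Matrix.diagonal x * A - Matrix.diagonal y + Cᵀ * C) (-(β • 1))) (v : ι → ℝ) :
    ∑ j, (C *ᵥ v) j ^ 2 + ∑ j, x j * (A *ᵥ v) j ^ 2 ≤ ∑ i, y i * v i ^ 2 := by
  have h1 := h.dotProduct_le v
  have h2 : 0 ≤ ∑ i, v i ^ 2 := by positivity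
  simp only [Matrix.add_mulVec, Matrix.sub_mulVec, Matrix.neg_mulVec, Matrix.smul_mulVec,
    Matrix.one_mulVec, dotProduct_add, dotProduct_sub, dotProduct_neg, dotProduct_smul,
    dotProduct_transpose_mul_mulVec, dotProduct_congruence_mulVec, dotProduct_diagonal_mulVec,
    smul_eq_mul] at h1
  have h3 : v ⬝ᵥ v = ∑ i, v i ^ 2 := by simp only [dotProduct, sq]
  rw [h3] at h1
  nlinarith [mul_nonneg hβ h2]

/-- A controllability Lyapunov inequality with diagonal solution bounds the reachability cost. -/
theorem sum_inv_mul_sq_le_of_ctrl [DecidableEq ι] [DecidableEq κ] {A : Matrix κ ι ℝ}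
    {B : Matrix κ μ ℝ} {x : κ → ℝ} {y : ι → ℝ} {β δ : ℝ} (hx : ∀ j, 0 < x j) (hy : ∀ i, 0 < y i)
    (hδ : δ < 1) (hβ : ∀ j, δ * x j ≤ β)
    (h : SLt (A * Matrix.diagonal y * Aᵀ - Matrix.diagonal x + B * Bᵀ) (-(β • 1)))
    (v : ι → ℝ) (u : μ → ℝ) :
    ∑ j, (x j)⁻¹ * (A *ᵥ v + B *ᵥ u) j ^ 2 ≤
      (1 - δ) * (∑ i, (y i)⁻¹ * v i ^ 2 + ∑ i, u i ^ 2) := by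
  have hδ' : 0 < 1 - δ := by linarith
  set w := A *ᵥ v + B *ᵥ u with hw
  -- Duality: testing the matrix inequality on `p = X⁻¹w` gives `a + b ≤ (1 - δ) Q`, where `Q = p ⬝ᵥ
  -- w` is the left side of the goal. Writing `Q` as `(Aᵀp) ⬝ᵥ v + (Bᵀp) ⬝ᵥ u` and using AM-GM with
  -- weight `1 - δ` bounds it by half of itself plus half of the goal's right side.
  set p : κ → ℝ := fun j => (x j)⁻¹ * w j with hp
  have h1 := h.dotProduct_le p
  have hA := dotProduct_congruence_mulVec Aᵀ (Matrix.diagonal y) p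
  have hB := dotProduct_transpose_mul_mulVec Bᵀ p
  rw [Matrix.transpose_transpose] at hA hB
  simp only [Matrix.add_mulVec, Matrix.sub_mulVec, Matrix.neg_mulVec, Matrix.smul_mulVec,
    Matrix.one_mulVec, dotProduct_add, dotProduct_sub, dotProduct_neg, dotProduct_smul,
    hA, hB, dotProduct_diagonal_mulVec, smul_eq_mul] at h1
  have h3 : β * (p ⬝ᵥ p) = ∑ j, β * p j ^ 2 := by simp only [dotProduct, sq, Finset.mul_sum]
  have h4 : δ * ∑ j, x j * p j ^ 2 ≤ β * (p ⬝ᵥ p) := by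
    rw [h3, Finset.mul_sum]
    exact Finset.sum_le_sum fun j _ => by nlinarith [sq_nonneg (p j), hβ j]
  have h5 : ∑ j, x j * p j ^ 2 = ∑ j, (x j)⁻¹ * w j ^ 2 :=
    Finset.sum_congr rfl fun j _ => by have := (hx j).ne'; simp only [hp]; field_simp
  have h6 : ∑ j, (x j)⁻¹ * w j ^ 2 = ∑ i, (Aᵀ *ᵥ p) i * v i + ∑ i, (Bᵀ *ᵥ p) i * u i := by
    have e1 : ∑ j, (x j)⁻¹ * w j ^ 2 = p ⬝ᵥ w :=
      Finset.sum_congr rfl fun j _ => by simp only [hp]; ring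
    rw [e1, hw, dotProduct_add, Matrix.dotProduct_mulVec, Matrix.dotProduct_mulVec,
      ← Matrix.mulVec_transpose, ← Matrix.mulVec_transpose]
    rfl
  have h7 : ∑ i, (Aᵀ *ᵥ p) i * v i ≤
      ∑ i, ((1 - δ)⁻¹ * (y i * (Aᵀ *ᵥ p) i ^ 2) + (1 - δ) * ((y i)⁻¹ * v i ^ 2)) / 2 := by
    refine Finset.sum_le_sum fun i _ => ?_
    have hyi := hy i
    have : ((1 - δ)⁻¹ * (y i * (Aᵀ *ᵥ p) i ^ 2) + (1 - δ) * ((y i)⁻¹ * v i ^ 2)) / 2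
        - (Aᵀ *ᵥ p) i * v i
        = (y i * (Aᵀ *ᵥ p) i - (1 - δ) * v i) ^ 2 / (2 * (1 - δ) * y i) := by
      field_simp; ring
    have : 0 ≤ (y i * (Aᵀ *ᵥ p) i - (1 - δ) * v i) ^ 2 / (2 * (1 - δ) * y i) := by positivity
    linarith
  have h8 : ∑ i, (Bᵀ *ᵥ p) i * u i ≤
      ∑ i, ((1 - δ)⁻¹ * ((Bᵀ *ᵥ p) i ^ 2) + (1 - δ) * (u i ^ 2)) / 2 := by
    refine Finset.sum_le_sum fun i _ => ?_
    have : ((1 - δ)⁻¹ * ((Bᵀ *ᵥ p) i ^ 2) + (1 - δ) * (u i ^ 2)) / 2 - (Bᵀ *ᵥ p) i * u i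
        = ((Bᵀ *ᵥ p) i - (1 - δ) * u i) ^ 2 / (2 * (1 - δ)) := by
      field_simp; ring
    have : 0 ≤ ((Bᵀ *ᵥ p) i - (1 - δ) * u i) ^ 2 / (2 * (1 - δ)) := by positivity
    linarith
  rw [← Finset.sum_div, Finset.sum_add_distrib, ← Finset.mul_sum, ← Finset.mul_sum] at h7 h8
  rw [h5] at h1 h4
  set Q := ∑ j, (x j)⁻¹ * w j ^ 2
  set a := ∑ i, y i * (Aᵀ *ᵥ p) i ^ 2
  set b := ∑ i, (Bᵀ *ᵥ p) i ^ 2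
  have h9 : (1 - δ)⁻¹ * (a + b) ≤ Q := by
    rw [inv_mul_le_iff₀ hδ']
    linarith
  linarith

/-- The triangle inequality in `ℓ₂`, in squared form and relative to a common mass `m`; it follows
from Cauchy–Schwarz for the cross term. -/
theorem sum_add_sq_le {f g : ι → ℝ} {a b m : ℝ} (ha : 0 ≤ a) (hb : 0 ≤ b) (hm : 0 ≤ m)
    (hf : ∑ i, f i ^ 2 ≤ a ^ 2 * m) (hg : ∑ i, g i ^ 2 ≤ b ^ 2 * m) :
    ∑ i, (f i + g i) ^ 2 ≤ (a + b) ^ 2 * m := by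
  have h1 := Finset.sum_mul_sq_le_sq_mul_sq Finset.univ f g
  have h2 : (∑ i, f i * g i) ^ 2 ≤ (a * b * m) ^ 2 :=
    h1.trans ((mul_le_mul hf hg (by positivity) (by positivity)).trans (by ring_nf; rfl))
  have h3 := (abs_le_of_sq_le_sq' h2 (by positivity)).2
  have h4 : ∑ i, (f i + g i) ^ 2 = ∑ i, f i ^ 2 + 2 * ∑ i, f i * g i + ∑ i, g i ^ 2 := by
    rw [Finset.mul_sum, ← Finset.sum_add_distrib, ← Finset.sum_add_distrib]
    exact Finset.sum_congr rfl fun i _ => by ring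
  rw [h4]
  nlinarith

end Matrices

section Graph

variable {V : Type*} [DecidableEq V] {E : Finset (V × V)}

/-- Every coordinate of the state is written by exactly one subsystem. -/
def outIdxEquiv (d : Slot E → ℕ) : (Σ s : Slot E, Fin (d s)) ≃ Σ k, OutIdx d k where
  toFun p := ⟨p.1.tail, ⟨⟨p.1, rfl⟩, p.2⟩⟩
  invFun p := ⟨p.2.1.1, p.2.2⟩
  left_inv _ := rfl
  right_inv := by rintro ⟨k, ⟨⟨s, rfl⟩, i⟩⟩; rfl

/-- Every coordinate of the state is read by exactly one subsystem. -/
def inIdxEquiv (d : Slot E → ℕ) : (Σ s : Slot E, Fin (d s)) ≃ Σ k, InIdx d k where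
  toFun p := ⟨p.1.head, ⟨⟨p.1, rfl⟩, p.2⟩⟩
  invFun p := ⟨p.2.1.1, p.2.2⟩
  left_inv _ := rfl
  right_inv := by rintro ⟨k, ⟨⟨s, rfl⟩, i⟩⟩; rfl

theorem sum_outIdx [Fintype V] (d : Slot E → ℕ) (g : ∀ k, OutIdx d k → ℝ) :
    ∑ k, ∑ p, g k p = ∑ s : Slot E, ∑ i, g s.tail ⟨⟨s, rfl⟩, i⟩ := by
  rw [← Fintype.sum_sigma', ← Fintype.sum_sigma']
  exact (Fintype.sum_equiv (outIdxEquiv d) _ _ fun p => rfl).symm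

theorem sum_inIdx [Fintype V] (d : Slot E → ℕ) (f : ∀ s, Fin (d s) → ℝ) :
    ∑ k, ∑ p : InIdx d k, f p.1.1 p.2 = ∑ s, ∑ i, f s i := by
  rw [← Fintype.sum_sigma', ← Fintype.sum_sigma']
  exact (Fintype.sum_equiv (inIdxEquiv d) _ _ fun p => rfl).symm

theorem diagIn_eq_diagonal {d : Slot E → ℕ} {X : ∀ s, Matrix (Fin (d s)) (Fin (d s)) ℝ}
    (hX : ∀ s, (X s).IsDiag) (k : V) :
    diagIn X k = Matrix.diagonal fun p : InIdx d k => X p.1.1 p.2 p.2 := by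
  refine Eq.trans ?_ (Matrix.blockDiagonal'_diagonal
    fun (s : InSlot E k) (i : Fin (d s.1)) => X s.1 i i)
  exact congrArg _ (funext fun s => (hX s.1).diagonal_diag.symm)

theorem diagOut_eq_diagonal {d : Slot E → ℕ} {X : ∀ s, Matrix (Fin (d s)) (Fin (d s)) ℝ}
    (hX : ∀ s, (X s).IsDiag) (k : V) :
    diagOut X k = Matrix.diagonal fun p : OutIdx d k => X p.1.1 p.2 p.2 := by
  refine Eq.trans ?_ (Matrix.blockDiagonal'_diagonal
    fun (s : OutSlot E k) (i : Fin (d s.1)) => X s.1 i i)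
  exact congrArg _ (funext fun s => (hX s.1).diagonal_diag.symm)

end Graph

end

/-! ### The error caused by resetting state variables to zero. -/

section

/-- A map is bounded in the induced norm if it is bounded on all finite horizons. -/
theorem inducedNorm_le {V : Type*} [Fintype V] {nu ny : ℕ → V → ℕ} {F : Signal nu → Signal ny}
    {c : ℝ} (hc : 0 ≤ c)
    (h : ∀ u T, ∑ t ∈ Finset.range T, ∑ k, ∑ j, F u t k j ^ 2 ≤
      c ^ 2 * ∑ t ∈ Finset.range T, ∑ k, ∑ j, u t k j ^ 2) :
    inducedNorm F ≤ ENNReal.ofReal c := by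
  have conv : ∀ {d : ℕ → V → ℕ} (w : Signal d) (T : ℕ),
      ∑ t ∈ Finset.range T, ∑ k, ∑ j, ENNReal.ofReal (w t k j ^ 2) =
      ENNReal.ofReal (∑ t ∈ Finset.range T, ∑ k, ∑ j, w t k j ^ 2) := fun w T => by
    rw [ENNReal.ofReal_sum_of_nonneg fun _ _ => by positivity]
    refine Finset.sum_congr rfl fun t _ => ?_
    rw [ENNReal.ofReal_sum_of_nonneg fun _ _ => by positivity]
    refine Finset.sum_congr rfl fun k _ => ?_
    rw [ENNReal.ofReal_sum_of_nonneg fun _ _ => by positivity]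
  refine iSup_le fun u => iSup_le fun _ => iSup_le fun _ => ENNReal.div_le_of_le_mul ?_
  have h1 : ∑' t, ∑ k, ∑ j, ENNReal.ofReal (F u t k j ^ 2) ≤
      ENNReal.ofReal c ^ 2 * ∑' t, ∑ k, ∑ j, ENNReal.ofReal (u t k j ^ 2) := by
    refine ENNReal.tsum_le_of_sum_range_le fun T => ?_
    refine le_trans ?_ (mul_le_mul_right (ENNReal.sum_le_tsum (Finset.range T)) _)
    rw [conv, conv, ← ENNReal.ofReal_pow hc, ← ENNReal.ofReal_mul (by positivity)]
    exact ENNReal.ofReal_le_ofReal (h u T)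
  have h2 := ENNReal.rpow_le_rpow h1 (by norm_num : (0 : ℝ) ≤ 1 / 2)
  rw [ENNReal.mul_rpow_of_nonneg _ _ (by norm_num), ← ENNReal.rpow_natCast,
    ← ENNReal.rpow_mul] at h2
  norm_num at h2
  simpa [l2norm] using h2

variable {V : Type*} [Fintype V] [DecidableEq V] {E : Finset (V × V)}

namespace Sys

variable {nu ny : ℕ → V → ℕ} (G : Sys E nu ny)

/-- The state at time `t + 1` when the state and the input at time `t` are `x` and `u`. -/
def next (t : ℕ) (x : ∀ s, Fin (G.n t s) → ℝ) (u : ∀ k, Fin (nu t k) → ℝ) :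
    ∀ s, Fin (G.n (t + 1) s) → ℝ := fun s i =>
  (G.A t s.tail *ᵥ (fun p => x p.1.1 p.2) + G.B t s.tail *ᵥ u s.tail) ⟨⟨s, rfl⟩, i⟩

/-- The value at time `t` of the output when the state and the input are `x` and `u`. -/
def outputAt (t : ℕ) (x : ∀ s, Fin (G.n t s) → ℝ) (u : ∀ k, Fin (nu t k) → ℝ) :
    ∀ k, Fin (ny t k) → ℝ := fun k =>
  G.C t k *ᵥ (fun p => x p.1.1 p.2) + G.D t k *ᵥ u k

open Classical in
/-- The state response when the variables outside `K` are reset to zero at every step. -/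
noncomputable def maskedState (K : ∀ t s, Set (Fin (G.n t s))) (u : Signal nu) :
    ∀ t s, Fin (G.n t s) → ℝ
  | 0 => 0
  | t + 1 => fun s i =>
      if i ∈ K (t + 1) s then G.next t (maskedState K u t) (u t) s i else 0

/-- The output when the variables outside `K` are reset to zero at every step. -/
noncomputable def maskedOutput (K : ∀ t s, Set (Fin (G.n t s))) (u : Signal nu) : Signal ny :=
  fun t => G.outputAt t (G.maskedState K u t) (u t)

theorem next_add (t : ℕ) (x x' : ∀ s, Fin (G.n t s) → ℝ) (u u' : ∀ k, Fin (nu t k) → ℝ) :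
    G.next t (x + x') (u + u') = G.next t x u + G.next t x' u' := by
  funext s i
  have h : (fun p : InIdx (G.n t) s.tail => (x + x') p.1.1 p.2) =
    (fun p => x p.1.1 p.2) + fun p => x' p.1.1 p.2 := rfl
  simp only [next]
  rw [h]
  simp only [next, Matrix.mulVec_add, Pi.add_apply]
  ring

theorem next_sub (t : ℕ) (x x' : ∀ s, Fin (G.n t s) → ℝ) (u u' : ∀ k, Fin (nu t k) → ℝ) :
    G.next t (x - x') (u - u') = G.next t x u - G.next t x' u' := by
  rw [eq_sub_iff_add_eq, ← next_add, sub_add_cancel, sub_add_cancel]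

theorem outputAt_sub (t : ℕ) (x x' : ∀ s, Fin (G.n t s) → ℝ) (u u' : ∀ k, Fin (nu t k) → ℝ) :
    G.outputAt t (x - x') (u - u') = G.outputAt t x u - G.outputAt t x' u' := by
  funext k i
  have h : (fun p : InIdx (G.n t) k => (x - x') p.1.1 p.2) =
    (fun p => x p.1.1 p.2) - fun p => x' p.1.1 p.2 := rfl
  simp only [outputAt]
  rw [h]
  simp only [outputAt, Matrix.mulVec_sub, Pi.sub_apply, Pi.add_apply]
  ring

theorem maskedState_univ (u : Signal nu) (t : ℕ) :
    G.maskedState (fun _ _ => Set.univ) u t = G.state u t := by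
  induction t with
  | zero => rfl
  | succ t ih =>
    funext s i
    simp only [maskedState, ih, Set.mem_univ, if_true, state, next]

theorem maskedOutput_univ (u : Signal nu) :
    G.maskedOutput (fun _ _ => Set.univ) u = G.output u := by
  funext t k
  simp only [maskedOutput, outputAt, maskedState_univ, output]

variable {G} {S : Family G.n}

/-- Summing the vertex inequalities gives a global one: each slot is written by one vertex and read
by one vertex, so the sums over `diagOut` and `diagIn` both become sums over slots. -/
theorem ObsvLyapunov.dissipation {β : ℝ} (hβ : 0 ≤ β) (hS : ∀ t s, (S t s).IsDiag)
    (h : G.ObsvLyapunov β S) (t : ℕ) (x : ∀ s, Fin (G.n t s) → ℝ) :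
    ∑ k, ∑ j, G.outputAt t x 0 k j ^ 2 + ∑ s, ∑ i, S (t + 1) s i i * G.next t x 0 s i ^ 2 ≤
      ∑ s, ∑ i, S t s i i * x s i ^ 2 := by
  have h1 : ∀ k, _ := fun k => by
    have h2 := h t k
    rw [diagOut_eq_diagonal (hS (t + 1)), diagIn_eq_diagonal (hS t)] at h2
    exact sum_sq_add_le_of_obsv hβ h2 fun p => x p.1.1 p.2
  have h3 := Finset.sum_le_sum fun k (_ : k ∈ Finset.univ) => h1 k
  rw [Finset.sum_add_distrib, sum_outIdx,
    sum_inIdx (G.n t) fun s i => S t s i i * x s i ^ 2] at h3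
  simpa only [outputAt, next, Pi.zero_apply, Matrix.mulVec_zero, add_zero] using h3

/-- The dual counterpart, with inverse weights. The factor `1 - δ` records the margin `β` relative
to the size of the gramians and is the source of strictness in the final bound. -/
theorem CtrlLyapunov.reachability {β δ : ℝ} (hS : ∀ t s, (S t s).IsDiag)
    (hpos : ∀ t s i, 0 < S t s i i) (hδ : δ < 1) (hβ : ∀ t s i, δ * S t s i i ≤ β)
    (h : G.CtrlLyapunov β S) (t : ℕ) (x : ∀ s, Fin (G.n t s) → ℝ) (u : ∀ k, Fin (nu t k) → ℝ) :
    ∑ s, ∑ i, (S (t + 1) s i i)⁻¹ * G.next t x u s i ^ 2 ≤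
      (1 - δ) * (∑ s, ∑ i, (S t s i i)⁻¹ * x s i ^ 2 + ∑ k, ∑ j, u k j ^ 2) := by
  have h1 : ∀ k, _ := fun k => by
    have h2 := h t k
    rw [diagOut_eq_diagonal (hS (t + 1)), diagIn_eq_diagonal (hS t)] at h2
    exact sum_inv_mul_sq_le_of_ctrl (fun p => hpos _ _ _) (fun p => hpos _ _ _) hδ
      (fun p => hβ _ _ _) h2 (fun p => x p.1.1 p.2) (u k)
  have h3 := Finset.sum_le_sum fun k (_ : k ∈ Finset.univ) => h1 k
  rw [← Finset.mul_sum, Finset.sum_add_distrib, sum_outIdx,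
    sum_inIdx (G.n t) fun s i => (S t s i i)⁻¹ * x s i ^ 2] at h3
  exact h3

/-- Removing state variables that share one value `σ` of the balanced gramians changes the output
by less than `2 σ` times the norm of the input. -/
theorem sum_maskedOutput_sub_sq_le {β δ σ : ℝ} (hβ0 : 0 ≤ β) (hS : ∀ t s, (S t s).IsDiag)
    (hpos : ∀ t s i, 0 < S t s i i) (hδ : δ < 1) (hδ0 : 0 ≤ δ) (hβ : ∀ t s i, δ * S t s i i ≤ β)
    (hc : G.CtrlLyapunov β S) (ho : G.ObsvLyapunov β S) (hσ : 0 < σ)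
    {K K' : ∀ t s, Set (Fin (G.n t s))} (hK : ∀ t s, K' t s ⊆ K t s)
    (hKσ : ∀ t s, ∀ i ∈ K t s, i ∉ K' t s → S t s i i = σ) (u : Signal nu) (T : ℕ) :
    ∑ t ∈ Finset.range T, ∑ k, ∑ j, (G.maskedOutput K u t k j - G.maskedOutput K' u t k j) ^ 2 ≤
      (1 - δ) * (2 * σ) ^ 2 * ∑ t ∈ Finset.range T, ∑ k, ∑ j, u t k j ^ 2 := by
  classical
  set x := G.maskedState K u with hx
  set x' := G.maskedState K' u with hx'
  -- Resetting does not increase the storage function. Coordinates kept in both responses are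
  -- unchanged, and coordinates reset in both contribute zero. A coordinate reset only in `x'` has
  -- both weights equal to `σ`, and `a² + a² ≤ (a - b)² + (a + b)²`.
  have step : ∀ t s i, S (t + 1) s i i * (x (t + 1) - x' (t + 1)) s i ^ 2 +
      σ ^ 2 * ((S (t + 1) s i i)⁻¹ * (x (t + 1) + x' (t + 1)) s i ^ 2) ≤
      S (t + 1) s i i * G.next t (x t - x' t) 0 s i ^ 2 +
      σ ^ 2 * ((S (t + 1) s i i)⁻¹ * G.next t (x t + x' t) (u t + u t) s i ^ 2) := by
    intro t s i
    have e := G.next_sub t (x t) (x' t) (u t) (u t)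
    rw [sub_self] at e
    rw [e, next_add]
    have p := hpos (t + 1) s i
    simp only [Pi.add_apply, Pi.sub_apply]
    have e1 : x (t + 1) s i = if i ∈ K (t + 1) s then G.next t (x t) (u t) s i else 0 := by
      rw [hx, maskedState]
    have e2 : x' (t + 1) s i = if i ∈ K' (t + 1) s then G.next t (x' t) (u t) s i else 0 := by
      rw [hx', maskedState]
    rw [e1, e2]
    generalize G.next t (x t) (u t) s i = a
    generalize G.next t (x' t) (u t) s i = b
    by_cases h' : i ∈ K' (t + 1) s
    · rw [if_pos h', if_pos (hK _ _ h')]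
    · by_cases hk : i ∈ K (t + 1) s
      · rw [if_pos hk, if_neg h', hKσ _ _ _ hk h']
        have e3 : ∀ y : ℝ, σ ^ 2 * (σ⁻¹ * y) = σ * y := fun y => by field_simp
        rw [e3, e3]
        nlinarith [mul_nonneg hσ.le (sq_nonneg b)]
      · rw [if_neg hk, if_neg h']
        simp only [sub_zero, add_zero, ne_eq, OfNat.ofNat_ne_zero, not_false_eq_true, zero_pow,
          mul_zero]
        positivity
  have key : ∀ T, ∑ t ∈ Finset.range T, ∑ k, ∑ j,
      (G.maskedOutput K u t k j - G.maskedOutput K' u t k j) ^ 2 +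
      (∑ s, ∑ i, S T s i i * (x T - x' T) s i ^ 2 +
        σ ^ 2 * ∑ s, ∑ i, (S T s i i)⁻¹ * (x T + x' T) s i ^ 2) ≤
      (1 - δ) * (2 * σ) ^ 2 * ∑ t ∈ Finset.range T, ∑ k, ∑ j, u t k j ^ 2 := by
    intro T
    induction T with
    | zero => simp [hx, hx', maskedState]
    | succ t ih =>
      rw [Finset.sum_range_succ, Finset.sum_range_succ]
      have h1 := ho.dissipation hβ0 hS t (x t - x' t)
      have h2 := hc.reachability hS hpos hδ hβ t (x t + x' t) (u t + u t)
      have h3 : ∑ s, ∑ i, S (t + 1) s i i * (x (t + 1) - x' (t + 1)) s i ^ 2 +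
        σ ^ 2 * ∑ s, ∑ i, (S (t + 1) s i i)⁻¹ * (x (t + 1) + x' (t + 1)) s i ^ 2 ≤
        ∑ s, ∑ i, S (t + 1) s i i * G.next t (x t - x' t) 0 s i ^ 2 +
        σ ^ 2 * ∑ s, ∑ i, (S (t + 1) s i i)⁻¹ * G.next t (x t + x' t) (u t + u t) s i ^ 2 := by
        simp only [Finset.mul_sum, ← Finset.sum_add_distrib]
        exact Finset.sum_le_sum fun s _ => Finset.sum_le_sum fun i _ => step t s i
      -- The sum `x + x'` is driven by `2u`, which gives the factor `4` in `(2 * σ) ^ 2`.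
      have h4 : ∑ k, ∑ j, (u t + u t) k j ^ 2 = 4 * ∑ k, ∑ j, u t k j ^ 2 := by
        simp only [Finset.mul_sum, Pi.add_apply]
        exact Finset.sum_congr rfl fun k _ => Finset.sum_congr rfl fun j _ => by ring
      have h5 : G.outputAt t (x t - x' t) 0 =
          G.maskedOutput K u t - G.maskedOutput K' u t := by
        have e := G.outputAt_sub t (x t) (x' t) (u t) (u t)
        rwa [sub_self] at e
      rw [h4] at h2
      rw [h5] at h1
      have h6 : 0 ≤ ∑ s, ∑ i, (S t s i i)⁻¹ * (x t + x' t) s i ^ 2 :=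
        Finset.sum_nonneg fun s _ => Finset.sum_nonneg fun i _ => by
          have := hpos t s i
          positivity
      have h7 := mul_le_mul_of_nonneg_left h2 (sq_nonneg σ)
      -- Only the input term needs the factor `1 - δ`; on the storage term it is weakened to `1`.
      have h8 := mul_nonneg (mul_nonneg hδ0 (sq_nonneg σ)) h6
      simp only [Pi.sub_apply] at ih h1 h3 ⊢
      nlinarith
  have h0 : 0 ≤ ∑ s, ∑ i, S T s i i * (x T - x' T) s i ^ 2 +
        σ ^ 2 * ∑ s, ∑ i, (S T s i i)⁻¹ * (x T + x' T) s i ^ 2 := by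
    refine add_nonneg ?_ (mul_nonneg (sq_nonneg σ) ?_) <;>
    exact Finset.sum_nonneg fun s _ => Finset.sum_nonneg fun i _ => by
      have := hpos T s i
      positivity
  linarith [key T]

/-- Removing state variables whose values in the balanced gramians lie in a finite set `F` changes
the output by less than twice the sum of `F`. -/
theorem sum_output_sub_maskedOutput_sq_le {β δ : ℝ} (hβ0 : 0 ≤ β) (hS : ∀ t s, (S t s).IsDiag)
    (hpos : ∀ t s i, 0 < S t s i i) (hδ : δ < 1) (hδ0 : 0 ≤ δ) (hβ : ∀ t s i, δ * S t s i i ≤ β)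
    (hc : G.CtrlLyapunov β S) (ho : G.ObsvLyapunov β S) (K : ∀ t s, Set (Fin (G.n t s)))
    (F : Finset ℝ) (hF : ∀ σ ∈ F, 0 < σ) (u : Signal nu) (T : ℕ) :
    ∑ t ∈ Finset.range T, ∑ k, ∑ j, (G.output u t k j -
      G.maskedOutput (fun t s => {i | i ∈ K t s ∨ S t s i i ∉ F}) u t k j) ^ 2 ≤
      (√(1 - δ) * (2 * ∑ σ ∈ F, σ)) ^ 2 * ∑ t ∈ Finset.range T, ∑ k, ∑ j, u t k j ^ 2 := by
  classical
  induction F using Finset.induction_on with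
  | empty =>
    have : (fun t s => {i | i ∈ K t s ∨ S t s i i ∉ (∅ : Finset ℝ)}) = fun _ _ => Set.univ := by
      funext t s; simp
    rw [this, maskedOutput_univ]
    simp
  | insert σ F hσF ih =>
    have ih' := ih fun x hx => hF x (Finset.mem_insert_of_mem hx)
    have hσ := hF σ (Finset.mem_insert_self _ _)
    -- Passing from `F` to `insert σ F` newly resets only variables outside `K` whose gramian value
    -- is exactly `σ`.
    have h1 := sum_maskedOutput_sub_sq_le hβ0 hS hpos hδ hδ0 hβ hc ho hσ
      (K := fun t s => {i | i ∈ K t s ∨ S t s i i ∉ F})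
      (K' := fun t s => {i | i ∈ K t s ∨ S t s i i ∉ insert σ F})
      (fun t s i hi => by
        simp only [Set.mem_ofPred_eq, Finset.mem_insert, not_or] at hi ⊢
        exact hi.imp id And.right)
      (fun t s i hi hi' => by
        simp only [Set.mem_ofPred_eq, Finset.mem_insert] at hi hi'
        tauto) u T
    have hF0 : 0 ≤ ∑ σ ∈ F, σ :=
      Finset.sum_nonneg fun x hx => (hF x (Finset.mem_insert_of_mem hx)).le
    have hm : 0 ≤ ∑ t ∈ Finset.range T, ∑ k, ∑ j, u t k j ^ 2 := by positivity
    have hs : √(1 - δ) ^ 2 = 1 - δ := Real.sq_sqrt (by linarith)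
    rw [← hs, ← mul_pow] at h1
    rw [Finset.sum_insert hσF]
    have e : √(1 - δ) * (2 * (σ + ∑ x ∈ F, x)) =
      √(1 - δ) * (2 * ∑ x ∈ F, x) + √(1 - δ) * (2 * σ) := by ring
    rw [e]
    -- The triple sums over time, vertex and component are flattened into one finite sum, to which
    -- the triangle inequality applies.
    simp only [← Finset.sum_coe_sort (Finset.range T), ← Fintype.sum_sigma'] at ih' h1 ⊢
    have h2 := sum_add_sq_le (by positivity) (by positivity) (by positivity) ih' h1
    simpa only [sub_add_sub_cancel] using h2

end Sys

end

/-! ### Eventually periodic sequences and principal subsystems. -/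

section

theorem IsETP.succ {α : Type*} {h q : ℕ} {f : ℕ → α} (hf : IsETP h q f) :
    IsETP h q fun t => f (t + 1) := fun t z => by
  have := hf (t + 1) z
  rwa [show t + 1 + h + z * q = t + h + z * q + 1 by ring, show t + 1 + h = t + h + 1 by ring]
    at this

theorem IsETP.exists_lt {α : Type*} {h q : ℕ} {f : ℕ → α} (hq : 0 < q) (hf : IsETP h q f) (t : ℕ) :
    ∃ t' < h + q, f t' = f t := by
  by_cases ht : t < h
  · exact ⟨t, by omega, rfl⟩
  · refine ⟨(t - h) % q + h, by have := Nat.mod_lt (t - h) hq; omega, ?_⟩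
    rw [← hf ((t - h) % q) ((t - h) / q)]
    congr 1
    have := Nat.mod_add_div (t - h) q
    rw [mul_comm] at this
    omega

theorem IsETP.prodMk {α β : Type*} {h q : ℕ} {f : ℕ → α} {g : ℕ → β} (hf : IsETP h q f)
    (hg : IsETP h q g) : IsETP h q fun t => (f t, g t) := fun t z => by
  simp only [hf t z, hg t z]

section Matrices

variable {ι κ μ ι' κ' : Type*} [Fintype ι] [Fintype ι']

/-- The sum defining the product splits into indices in the range of `e` and the remaining ones; the
latter form the positive semidefinite term lost by truncation. -/
theorem submatrix_mul_diagonal_mul_transpose [DecidableEq ι] [DecidableEq ι']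
    (A : Matrix κ ι ℝ) (y : ι → ℝ) {f : κ' → κ}
    {e : ι' → ι} (he : e.Injective) [DecidablePred (· ∈ Set.range e)] :
    A.submatrix f e * Matrix.diagonal (y ∘ e) * (A.submatrix f e)ᵀ =
      (A * Matrix.diagonal y * Aᵀ).submatrix f f - A.submatrix f id *
        Matrix.diagonal (fun i => if i ∈ Set.range e then 0 else y i) * (A.submatrix f id)ᵀ := by
  ext i j
  simp only [Matrix.sub_apply, Matrix.submatrix_apply, Matrix.mul_apply (M := _ * _),
    Matrix.mul_diagonal, Matrix.transpose_apply, id, ← Finset.sum_sub_distrib]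
  refine Fintype.sum_of_injective e he _ _ (fun p hp => ?_) (fun p => ?_)
  · rw [if_neg hp]; ring
  · rw [if_pos ⟨p, rfl⟩, Function.comp]; ring

theorem SLt.submatrix {M N : Matrix ι ι ℝ} (h : SLt M N) {e : ι' → ι} (he : e.Injective) :
    SLt (M.submatrix e e) (N.submatrix e e) := by
  have := Matrix.PosDef.submatrix h he
  rwa [Matrix.submatrix_sub] at this

/-- A Lyapunov inequality with diagonal solution restricts to principal subsystems. -/
theorem SLt.lyapunov_submatrix [Fintype κ] [Fintype μ] [Fintype κ'] [DecidableEq ι] [DecidableEq κ]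
    [DecidableEq ι'] [DecidableEq κ'] {A : Matrix κ ι ℝ} {B : Matrix κ μ ℝ}
    {x : κ → ℝ} {y : ι → ℝ} {β : ℝ} (hy : ∀ i, 0 ≤ y i)
    (h : SLt (A * Matrix.diagonal y * Aᵀ - Matrix.diagonal x + B * Bᵀ) (-(β • 1)))
    {f : κ' → κ} {e : ι' → ι} (hf : f.Injective) (he : e.Injective) :
    SLt (A.submatrix f e * Matrix.diagonal (y ∘ e) * (A.submatrix f e)ᵀ -
      Matrix.diagonal (x ∘ f) + B.submatrix f id * (B.submatrix f id)ᵀ) (-(β • 1)) := by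
  classical
  have h1 := h.submatrix hf
  have h2 := (Matrix.PosSemidef.diagonal (n := ι) (R := ℝ)
    (d := fun i => if i ∈ Set.range e then 0 else y i)
    (fun i => by dsimp only; split_ifs; exacts [le_rfl, hy i])).mul_mul_conjTranspose_same
      (A.submatrix f id)
  have h3 := Matrix.PosDef.add_posSemidef h1 h2
  rw [SLt, submatrix_mul_diagonal_mul_transpose A y he]
  convert h3 using 1
  have e1 : B.submatrix f id * (B.submatrix f id)ᵀ = (B * Bᵀ).submatrix f f := by
    ext i j; simp [Matrix.mul_apply]
  have e2 : (1 : Matrix κ κ ℝ).submatrix f f = 1 := Matrix.submatrix_one f hf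
  have e3 : (Matrix.diagonal x).submatrix f f = Matrix.diagonal (x ∘ f) :=
    Matrix.submatrix_diagonal x f hf
  rw [e1, Matrix.conjTranspose_eq_transpose_of_trivial, ← e3, ← e2]
  ext i j
  simp
  ring

end Matrices

end

/-! ### Balanced truncation and its error bound. -/

section

variable {V : Type*} {E : Finset (V × V)}

theorem castLE_out_injective {d r : Slot E → ℕ} (hr : ∀ s, r s ≤ d s) (k : V) :
    Function.Injective (fun p : OutIdx r k => (⟨p.1, Fin.castLE (hr p.1.1) p.2⟩ : OutIdx d k)) := by
  rintro ⟨s, i⟩ ⟨s', i'⟩ h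
  obtain ⟨rfl, h2⟩ := Sigma.mk.inj_iff.1 h
  obtain rfl := Fin.castLE_injective _ (eq_of_heq h2)
  rfl

theorem castLE_in_injective {d r : Slot E → ℕ} (hr : ∀ s, r s ≤ d s) (k : V) :
    Function.Injective (fun p : InIdx r k => (⟨p.1, Fin.castLE (hr p.1.1) p.2⟩ : InIdx d k)) := by
  rintro ⟨s, i⟩ ⟨s', i'⟩ h
  obtain ⟨rfl, h2⟩ := Sigma.mk.inj_iff.1 h
  obtain rfl := Fin.castLE_injective _ (eq_of_heq h2)
  rfl

theorem Family.UniformlyPosDef.diag_pos {n : ℕ → Slot E → ℕ} {X : Family n} {β : ℝ}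
    (hβ : 0 ≤ β) (hX : X.UniformlyPosDef β) (t : ℕ) (s : Slot E) (i : Fin (n t s)) :
    0 < X t s i i := by
  have h := Matrix.PosDef.diag_pos (hX.1 t s) (i := i)
  simp at h
  linarith

theorem Family.UniformlyPosDef.exists_diag_le {n : ℕ → Slot E → ℕ} {X : Family n} {β : ℝ}
    (hX : X.UniformlyPosDef β) : ∃ c, ∀ t s i, X t s i i ≤ c := by
  obtain ⟨c, hc⟩ := hX.2
  refine ⟨c, fun t s i => ?_⟩
  have h := Matrix.PosDef.diag_pos (hc t s) (i := i)
  simp at h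
  linarith

theorem Family.UniformlyPosDef.kept {n : ℕ → Slot E → ℕ} {X : Family n} {β : ℝ}
    (hX : X.UniformlyPosDef β) (r : ℕ → Slot E → ℕ) (hr : ∀ t s, r t s ≤ n t s) :
    (X.kept r hr).UniformlyPosDef β := by
  obtain ⟨h1, c, h2⟩ := hX
  have e : ∀ (t : ℕ) (s : Slot E) (b : ℝ),
      (b • (1 : Matrix (Fin (n t s)) (Fin (n t s)) ℝ)).submatrix (Fin.castLE (hr t s))
        (Fin.castLE (hr t s)) = b • 1 := fun t s b => by
    rw [Matrix.submatrix_smul, Pi.smul_apply, Pi.smul_apply,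
      Matrix.submatrix_one _ (Fin.castLE_injective _)]
  refine ⟨fun t s => ?_, c, fun t s => ?_⟩
  · rw [← e]
    exact (h1 t s).submatrix (Fin.castLE_injective _)
  · rw [← e]
    exact (h2 t s).submatrix (Fin.castLE_injective _)

theorem Family.IsETP.kept {n : ℕ → Slot E → ℕ} {X : Family n} {h q : ℕ} (hX : X.IsETP h q)
    {r : ℕ → Slot E → ℕ} (hr : ∀ t s, r t s ≤ n t s) (hrE : DistSys.IsETP h q r) :
    (X.kept r hr).IsETP h q := by
  -- Dimensions vary with time, so periodicity is an equality of dependent pairs. Stating the claim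
  -- for arbitrary pairs allows substitution along that equality; the same device recurs below.
  have key : ∀ (a b : Σ d : Slot E → ℕ, ∀ s, Matrix (Fin (d s)) (Fin (d s)) ℝ) (r r' : Slot E → ℕ)
      (ha : ∀ s, r s ≤ a.1 s) (hb : ∀ s, r' s ≤ b.1 s), a = b → r = r' →
      (⟨r, fun s => (a.2 s).submatrix (Fin.castLE (ha s)) (Fin.castLE (ha s))⟩ :
        Σ d : Slot E → ℕ, ∀ s, Matrix (Fin (d s)) (Fin (d s)) ℝ) =
      ⟨r', fun s => (b.2 s).submatrix (Fin.castLE (hb s)) (Fin.castLE (hb s))⟩ := by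
    rintro a b r r' ha hb rfl rfl
    rfl
  exact fun t z => key _ _ _ _ (hr _) (hr _) (hX t z) (hrE t z)

/-- The values of the truncated variables at all times occur within the first `h + q` steps. -/
theorem Family.IsETP.mem_image_cut [Fintype V] [DecidableEq V] {n : ℕ → Slot E → ℕ} {X : Family n}
    {h q : ℕ} (hq : 0 < q) (hX : X.IsETP h q) {r : ℕ → Slot E → ℕ} (hr : DistSys.IsETP h q r)
    (t : ℕ) (s : Slot E) (i : Fin (n t s)) (hi : r t s ≤ i) :
    X t s i i ∈ Finset.univ.image fun i => (X.cut r).diagUpTo (h + q) i i := by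
  obtain ⟨t', ht', e⟩ := (IsETP.prodMk hX hr).exists_lt hq t
  have e1 := (Prod.mk.inj e).1
  have e2 : r t' = r t := (Prod.mk.inj e).2
  have key : ∀ a b : (Σ d : Slot E → ℕ, ∀ s, Matrix (Fin (d s)) (Fin (d s)) ℝ), a = b →
      ∀ (i : Fin (b.1 s)), ∃ j : Fin (a.1 s), (j : ℕ) = i ∧ a.2 s j j = b.2 s i i := by
    rintro a b rfl i
    exact ⟨i, rfl, rfl⟩
  obtain ⟨j, hj, hj'⟩ := key _ _ e1 i
  dsimp only at j hj hj'
  have hlt := j.2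
  have e3 : r t' s ≤ j := by rw [e2, hj]; exact hi
  refine Finset.mem_image.2 ⟨⟨⟨t', ht'⟩, s, ⟨j - r t' s, by dsimp only; omega⟩⟩,
    Finset.mem_univ _, ?_⟩
  rw [Family.diagUpTo, Matrix.blockDiagonal'_apply_eq, Matrix.blockDiagonal'_apply_eq, Family.cut,
    Matrix.submatrix_apply, ← hj']
  have e4 : (⟨r t' s + (j - r t' s), by omega⟩ : Fin (n t' s)) = j := Fin.ext (by simp; omega)
  rw [e4]

theorem Family.cut_diagUpTo_apply [DecidableEq V] {n : ℕ → Slot E → ℕ} (X : Family n)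
    (r : ℕ → Slot E → ℕ) (m : ℕ)
    (i : Σ t : Fin m, Σ s, Fin (n t s - r t s)) :
    (X.cut r).diagUpTo m i i = X i.1 i.2.1 ⟨r i.1 i.2.1 + i.2.2, by omega⟩
      ⟨r i.1 i.2.1 + i.2.2, by omega⟩ := by
  obtain ⟨t, s, i⟩ := i
  rw [Family.diagUpTo, Matrix.blockDiagonal'_apply_eq, Matrix.blockDiagonal'_apply_eq, Family.cut,
    Matrix.submatrix_apply]

namespace Sys

variable {nu ny : ℕ → V → ℕ} {G : Sys E nu ny} {S : Family G.n}

theorem IsETP.truncate {h q : ℕ} (hG : G.IsETP h q) {r : ℕ → Slot E → ℕ}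
    (hr : ∀ t s, r t s ≤ G.n t s) (hrE : DistSys.IsETP h q r) : (G.truncate r hr).IsETP h q := by
  have key : ∀ (a b : Σ d : (Slot E → ℕ) × (Slot E → ℕ) × (V → ℕ) × (V → ℕ),
        (∀ k, Matrix (OutIdx d.1 k) (InIdx d.2.1 k) ℝ) ×
        (∀ k, Matrix (OutIdx d.1 k) (Fin (d.2.2.1 k)) ℝ) ×
        (∀ k, Matrix (Fin (d.2.2.2 k)) (InIdx d.2.1 k) ℝ) ×
        (∀ k, Matrix (Fin (d.2.2.2 k)) (Fin (d.2.2.1 k)) ℝ))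
      (r₁ r₀ r₁' r₀' : Slot E → ℕ) (h₁ : ∀ s, r₁ s ≤ a.1.1 s) (h₀ : ∀ s, r₀ s ≤ a.1.2.1 s)
      (h₁' : ∀ s, r₁' s ≤ b.1.1 s) (h₀' : ∀ s, r₀' s ≤ b.1.2.1 s),
      a = b → r₁ = r₁' → r₀ = r₀' →
      (⟨(r₁, r₀, a.1.2.2.1, a.1.2.2.2),
        (fun k => (a.2.1 k).submatrix (fun p => ⟨p.1, Fin.castLE (h₁ p.1.1) p.2⟩)
          (fun p => ⟨p.1, Fin.castLE (h₀ p.1.1) p.2⟩),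
        fun k => (a.2.2.1 k).submatrix (fun p => ⟨p.1, Fin.castLE (h₁ p.1.1) p.2⟩) id,
        fun k => (a.2.2.2.1 k).submatrix id (fun p => ⟨p.1, Fin.castLE (h₀ p.1.1) p.2⟩),
        a.2.2.2.2)⟩ :
      Σ d : (Slot E → ℕ) × (Slot E → ℕ) × (V → ℕ) × (V → ℕ),
        (∀ k, Matrix (OutIdx d.1 k) (InIdx d.2.1 k) ℝ) ×
        (∀ k, Matrix (OutIdx d.1 k) (Fin (d.2.2.1 k)) ℝ) ×
        (∀ k, Matrix (Fin (d.2.2.2 k)) (InIdx d.2.1 k) ℝ) ×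
        (∀ k, Matrix (Fin (d.2.2.2 k)) (Fin (d.2.2.1 k)) ℝ)) =
      ⟨(r₁', r₀', b.1.2.2.1, b.1.2.2.2),
        (fun k => (b.2.1 k).submatrix (fun p => ⟨p.1, Fin.castLE (h₁' p.1.1) p.2⟩)
          (fun p => ⟨p.1, Fin.castLE (h₀' p.1.1) p.2⟩),
        fun k => (b.2.2.1 k).submatrix (fun p => ⟨p.1, Fin.castLE (h₁' p.1.1) p.2⟩) id,
        fun k => (b.2.2.2.1 k).submatrix id (fun p => ⟨p.1, Fin.castLE (h₀' p.1.1) p.2⟩),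
        b.2.2.2.2)⟩ := by
    rintro a b r₁ r₀ r₁' r₀' h₁ h₀ h₁' h₀' rfl rfl rfl
    rfl
  exact fun t z => key _ _ _ _ _ _ (hr _) (hr _) (hr _) (hr _) (hG t z) (hrE.succ t z) (hrE t z)

variable [Fintype V] [DecidableEq V]

theorem IsBalancedBy.truncate (hS : G.IsBalancedBy S) (r : ℕ → Slot E → ℕ)
    (hr : ∀ t s, r t s ≤ G.n t s) : (G.truncate r hr).IsBalancedBy (S.kept r hr) := by
  obtain ⟨hd, β, hβ, hu, hc, ho⟩ := hS
  have hd' : ∀ t s, (S.kept r hr t s).IsDiag := fun t s =>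
    (hd t s).submatrix (Fin.castLE_injective _)
  refine ⟨hd', β, hβ, hu.kept r hr, fun t k => ?_, fun t k => ?_⟩
  · have h := hc t k
    rw [diagOut_eq_diagonal (hd (t + 1)), diagIn_eq_diagonal (hd t)] at h
    have h' := h.lyapunov_submatrix (fun p => (hu.diag_pos hβ.le _ _ _).le)
      (castLE_out_injective (hr (t + 1)) k) (castLE_in_injective (hr t) k)
    have e1 := diagOut_eq_diagonal (hd' (t + 1)) k
    have e2 := diagIn_eq_diagonal (hd' t) k
    exact Eq.mpr (congrArg₂ (fun X Y => SLt ((G.truncate r hr).A t k * Y * ((G.truncate r hr).A t k)ᵀ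
      - X + (G.truncate r hr).B t k * ((G.truncate r hr).B t k)ᵀ) (-(β • 1))) e1 e2) h'
  · have h := ho t k
    rw [diagOut_eq_diagonal (hd (t + 1)), diagIn_eq_diagonal (hd t)] at h
    -- The observability inequality is the controllability inequality of the transposed data, with
    -- the roles of the two gramian families exchanged.
    have h' := SLt.lyapunov_submatrix (A := (G.A t k)ᵀ) (B := (G.C t k)ᵀ)
      (fun p => (hu.diag_pos hβ.le _ _ _).le) h
      (castLE_in_injective (hr t) k) (castLE_out_injective (hr (t + 1)) k)
    have e1 := diagOut_eq_diagonal (hd' (t + 1)) k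
    have e2 := diagIn_eq_diagonal (hd' t) k
    exact Eq.mpr (congrArg₂ (fun X Y => SLt (((G.truncate r hr).A t k)ᵀ * X * (G.truncate r hr).A t k
      - Y + ((G.truncate r hr).C t k)ᵀ * (G.truncate r hr).C t k) (-(β • 1))) e1 e2) h'

/-- The observability gramian is a Lyapunov solution once the positive semidefinite term `CᵀC` is
dropped. -/
theorem IsBalancedBy.stronglyStable (hS : G.IsBalancedBy S) : G.StronglyStable := by
  obtain ⟨-, β, hβ, hu, -, ho⟩ := hS
  refine ⟨β, hβ, S, hu, fun t k => ?_⟩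
  have h := Matrix.PosDef.add_posSemidef (ho t k)
    (Matrix.posSemidef_conjTranspose_mul_self (G.C t k))
  rw [Matrix.conjTranspose_eq_transpose_of_trivial] at h
  rw [SLt]
  convert h using 1
  abel

/-- A truncated matrix acts on a vector as the full matrix acts on its extension by zero. -/
theorem mulVec_castLE {d r : Slot E → ℕ} (hr : ∀ s, r s ≤ d s) {κ κ' : Type*} {k : V}
    (M : Matrix κ (InIdx d k) ℝ) (f : κ' → κ) {x : ∀ s, Fin (d s) → ℝ} {y : ∀ s, Fin (r s) → ℝ}
    (hxy : ∀ s i, x s (Fin.castLE (hr s) i) = y s i) (hx : ∀ s (i : Fin (d s)), r s ≤ i → x s i = 0)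
    (j : κ') :
    (M.submatrix f (fun p : InIdx r k => ⟨p.1, Fin.castLE (hr p.1.1) p.2⟩) *ᵥ
      fun p => y p.1.1 p.2) j = (M *ᵥ fun p => x p.1.1 p.2) (f j) := by
  refine Fintype.sum_of_injective _ (castLE_in_injective hr k) _ _ (fun p hp => ?_) (fun p => ?_)
  · have hle : r p.1.1 ≤ (p.2 : ℕ) := by
      by_contra hlt
      exact hp ⟨⟨p.1, ⟨p.2, not_le.1 hlt⟩⟩, rfl⟩
    exact mul_eq_zero_of_right _ (hx _ _ hle)
  · exact congrArg (M _ _ * ·) (hxy _ _).symm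

variable (G) in
/-- The states of a truncated system are those of the original system with the truncated variables
reset to zero at every step. -/
theorem maskedState_truncate (r : ℕ → Slot E → ℕ) (hr : ∀ t s, r t s ≤ G.n t s) (u : Signal nu)
    (t : ℕ) :
    (∀ s (i : Fin (r t s)), G.maskedState (fun t s => {i : Fin (G.n t s) | (i : ℕ) < r t s}) u t s
      (Fin.castLE (hr t s) i) = (G.truncate r hr).state u t s i) ∧
    ∀ s (i : Fin (G.n t s)), r t s ≤ i →
      G.maskedState (fun t s => {i : Fin (G.n t s) | (i : ℕ) < r t s}) u t s i = 0 := by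
  induction t with
  | zero => exact ⟨fun s i => rfl, fun s i _ => rfl⟩
  | succ t ih =>
    refine ⟨fun s i => ?_, fun s i hi => ?_⟩
    · have h := mulVec_castLE (hr t) (G.A t s.tail) (fun p : OutIdx (r (t + 1)) s.tail =>
        ⟨p.1, Fin.castLE (hr (t + 1) p.1.1) p.2⟩) ih.1 ih.2 ⟨⟨s, rfl⟩, i⟩
      exact (if_pos i.2).trans (congrArg (· + (G.B t s.tail *ᵥ u t s.tail)
        ⟨⟨s, rfl⟩, Fin.castLE (hr (t + 1) s) i⟩) h.symm)
    · exact if_neg (not_lt.2 hi)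

variable (G) in
theorem maskedOutput_truncate (r : ℕ → Slot E → ℕ) (hr : ∀ t s, r t s ≤ G.n t s) (u : Signal nu) :
    G.maskedOutput (fun t s => {i : Fin (G.n t s) | (i : ℕ) < r t s}) u =
      (G.truncate r hr).output u := by
  funext t k j
  obtain ⟨h1, h2⟩ := G.maskedState_truncate r hr u t
  exact congrArg (· + (G.D t k *ᵥ u t k) j) (mulVec_castLE (hr t) (G.C t k) id h1 h2 j).symm

theorem IsBalancedBy.inducedNorm_truncate_lt {h q : ℕ} (hq : 0 < q) (hS : G.IsBalancedBy S)
    (hE : S.IsETP h q) (r : ℕ → Slot E → ℕ)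
    (hr : ∀ t s, r t s ≤ G.n t s) (hrE : DistSys.IsETP h q r) (hlt : ∃ t s, r t s < G.n t s) :
    inducedNorm (fun u => G.output u - (G.truncate r hr).output u) <
      ENNReal.ofReal (2 * zeta ((S.cut r).diagUpTo (h + q))) := by
  obtain ⟨hd, β, hβ, hu, hc, ho⟩ := hS
  have hpos := hu.diag_pos hβ.le
  obtain ⟨c, hc'⟩ := hu.exists_diag_le
  obtain ⟨δ, hδ0, hδ1, hδ⟩ : ∃ δ : ℝ, 0 < δ ∧ δ < 1 ∧ ∀ t s i, δ * S t s i i ≤ β := by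
    have hm : 0 < max c 1 := by positivity
    -- The second entry makes `δ * S ≤ β` for gramians bounded by `c`; the maximum with `1` keeps
    -- the divisor positive even if there are no state variables.
    refine ⟨min (1 / 2) (β / max c 1), lt_min (by norm_num) (by positivity),
      (min_le_left _ _).trans_lt (by norm_num), fun t s i => ?_⟩
    calc _ ≤ β / max c 1 * max c 1 :=
          mul_le_mul (min_le_right _ _) ((hc' t s i).trans (le_max_left _ _)) (hpos t s i).le
            (by positivity)
      _ = β := div_mul_cancel₀ _ hm.ne'
  set F := Finset.univ.image fun i => (S.cut r).diagUpTo (h + q) i i with hFdef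
  have hF : ∀ σ ∈ F, 0 < σ := fun σ hσ => by
    obtain ⟨i, -, rfl⟩ := Finset.mem_image.1 hσ
    rw [Family.cut_diagUpTo_apply]
    exact hpos _ _ _
  have hmem := fun t s i => hE.mem_image_cut hq hrE t s i
  -- Every truncated variable has its value in `F`, so resetting the variables outside the kept
  -- range with value in `F` is exactly truncation.
  have hK : (fun t s => {i : Fin (G.n t s) | i ∈ {i : Fin (G.n t s) | (i : ℕ) < r t s} ∨
      S t s i i ∉ F}) = fun t s => {i : Fin (G.n t s) | (i : ℕ) < r t s} := by
    funext t s
    ext i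
    simp only [Set.mem_ofPred_eq, or_iff_left_iff_imp]
    intro hi
    by_contra hi'
    exact hi (hmem t s i (not_lt.1 hi'))
  -- At least one truncated variable makes `F` nonempty; without this the strict inequality would
  -- fail.
  have hζ : 0 < ∑ σ ∈ F, σ := by
    obtain ⟨t, s, hts⟩ := hlt
    exact Finset.sum_pos hF ⟨_, hmem t s ⟨r t s, hts⟩ le_rfl⟩
  have hbound := inducedNorm_le (F := fun u => G.output u - (G.truncate r hr).output u)
    (c := √(1 - δ) * (2 * ∑ σ ∈ F, σ)) (by positivity) fun u T => by
      have := sum_output_sub_maskedOutput_sq_le hβ.le hd hpos hδ1 hδ0.le hδ hc ho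
        (fun t s => {i : Fin (G.n t s) | (i : ℕ) < r t s}) F hF u T
      rw [hK, maskedOutput_truncate] at this
      exact this
  refine hbound.trans_lt ((ENNReal.ofReal_lt_ofReal_iff ?_).2 ?_)
  · exact mul_pos two_pos hζ
  · have : √(1 - δ) < 1 := by rw [Real.sqrt_lt' one_pos]; linarith
    have e : zeta ((S.cut r).diagUpTo (h + q)) = ∑ σ ∈ F, σ := rfl
    rw [e]
    nlinarith

end Sys

end

/-! ### Factorization of positive definite matrices, and families padded to infinite matrices. -/

section

section Matrices

variable {ι κ : Type*} [Fintype ι] [Fintype κ]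

theorem SLt.of_dotProduct_lt {M N : Matrix ι ι ℝ} (hM : M.IsHermitian) (hN : N.IsHermitian)
    (h : ∀ v, v ≠ 0 → v ⬝ᵥ (M *ᵥ v) < v ⬝ᵥ (N *ᵥ v)) : SLt M N := by
  refine .of_dotProduct_mulVec_pos (hN.sub hM) fun v hv => ?_
  rw [star_trivial, Matrix.sub_mulVec, dotProduct_sub, sub_pos]
  exact h v hv

theorem dotProduct_smul_one_mulVec [DecidableEq ι] (b : ℝ) (v : ι → ℝ) :
    v ⬝ᵥ ((b • (1 : Matrix ι ι ℝ)) *ᵥ v) = b * (v ⬝ᵥ v) := by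
  rw [Matrix.smul_mulVec, Matrix.one_mulVec, dotProduct_smul, smul_eq_mul]

theorem dotProduct_self_pos {v : ι → ℝ} (hv : v ≠ 0) : 0 < v ⬝ᵥ v := by
  rw [← star_trivial v]
  exact Matrix.dotProduct_star_self_pos_iff.2 hv

theorem dotProduct_self_nonneg (v : ι → ℝ) : 0 ≤ v ⬝ᵥ v :=
  Finset.sum_nonneg fun _ _ => mul_self_nonneg _

open scoped MatrixOrder Matrix.Norms.L2Operator in
theorem exists_transpose_mul_self [DecidableEq ι] {M : Matrix ι ι ℝ} (hM : M.PosDef) :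
    ∃ T : Matrix ι ι ℝ, IsUnit T ∧ Tᵀ * T = M := by
  obtain ⟨T, rfl⟩ := CStarAlgebra.nonneg_iff_eq_star_mul_self.mp hM.posSemidef.nonneg
  rw [Matrix.star_eq_conjTranspose, Matrix.conjTranspose_eq_transpose_of_trivial] at *
  refine ⟨T, ?_, rfl⟩
  have := hM.isUnit
  rw [Matrix.isUnit_iff_isUnit_det, Matrix.det_mul] at this
  exact (Matrix.isUnit_iff_isUnit_det _).2 (isUnit_of_mul_isUnit_right this)

end Matrices

section BlockDiagonal

variable {o : Type*} [Fintype o] [DecidableEq o] {m : o → Type*} [∀ i, Fintype (m i)]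

theorem blockDiagonal'_mulVec (X : ∀ i, Matrix (m i) (m i) ℝ) (v : (Σ i, m i) → ℝ) (p : Σ i, m i) :
    (Matrix.blockDiagonal' X *ᵥ v) p = (X p.1 *ᵥ fun j => v ⟨p.1, j⟩) p.2 := by
  obtain ⟨i, a⟩ := p
  simp only [Matrix.mulVec, dotProduct, Fintype.sum_sigma]
  rw [Finset.sum_eq_single i]
  · simp only [Matrix.blockDiagonal'_apply_eq]
  · intro b _ hb
    exact Finset.sum_eq_zero fun x _ => by rw [Matrix.blockDiagonal'_apply_ne _ _ _ hb.symm, zero_mul]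
  · simp

theorem dotProduct_blockDiagonal'_mulVec (X : ∀ i, Matrix (m i) (m i) ℝ) (v : (Σ i, m i) → ℝ) :
    v ⬝ᵥ (Matrix.blockDiagonal' X *ᵥ v) =
      ∑ i, (fun j => v ⟨i, j⟩) ⬝ᵥ (X i *ᵥ fun j => v ⟨i, j⟩) := by
  simp only [dotProduct, blockDiagonal'_mulVec, Fintype.sum_sigma]

end BlockDiagonal

variable {V : Type*} {E : Finset (V × V)}

/-- The `d × d` leading blocks of infinite matrices. -/
def leading (d : Slot E → ℕ) (Y : Slot E → ℕ → ℕ → ℝ) : ∀ s, Matrix (Fin (d s)) (Fin (d s)) ℝ :=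
  fun s => Matrix.of fun i j => Y s i j

/-- Extension of a family of matrices by zeros to infinite matrices. -/
def Family.extend {n : ℕ → Slot E → ℕ} (X : Family n) (t : ℕ) (s : Slot E) (a b : ℕ) : ℝ :=
  if h : a < n t s ∧ b < n t s then X t s ⟨a, h.1⟩ ⟨b, h.2⟩ else 0

theorem Family.leading_extend {n : ℕ → Slot E → ℕ} (X : Family n) (t : ℕ) :
    leading (n t) (X.extend t) = X t := by
  funext s
  ext i j
  simp [leading, Family.extend]

theorem leading_smul (d : Slot E → ℕ) (c : ℝ) (Y : Slot E → ℕ → ℕ → ℝ) (s : Slot E) :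
    leading d (c • Y) s = c • leading d Y s := rfl

theorem leading_sum (d : Slot E → ℕ) (Y : ℕ → Slot E → ℕ → ℕ → ℝ) (N : ℕ) (s : Slot E) :
    leading d (∑ z ∈ Finset.range N, Y z) s = ∑ z ∈ Finset.range N, leading d (Y z) s := by
  ext i j
  simp [leading, Matrix.sum_apply, Finset.sum_apply]

theorem isHermitian_leading {Y : Slot E → ℕ → ℕ → ℝ} (hY : ∀ s a b, Y s a b = Y s b a)
    (d : Slot E → ℕ) (s : Slot E) : (leading d Y s).IsHermitian := by
  ext i j
  simp [leading, hY s j i]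

end

/-! ### An eventually periodic solution of the Lyapunov inequalities. -/

section

theorem IsETP.apply_mod {α : Type*} {h q : ℕ} {f : ℕ → α} (hf : IsETP h q f) {t : ℕ} (ht : h ≤ t)
    (z : ℕ) : f (h + (t - h) % q + z * q) = f t := by
  have h1 := hf ((t - h) % q) z
  have h2 := hf ((t - h) % q) ((t - h) / q)
  have e : (t - h) % q + h + (t - h) / q * q = t := by
    have := Nat.mod_add_div (t - h) q
    rw [mul_comm] at this
    omega
  rw [e] at h2
  rw [add_comm h, h1, h2]

variable {V : Type*} {E : Finset (V × V)}

theorem Sys.IsETP.dim {nu ny : ℕ → V → ℕ} {G : Sys E nu ny} {h q : ℕ} (hG : G.IsETP h q) :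
    DistSys.IsETP h q G.n :=
  fun t z => congrArg (fun a => a.1.2.1) (hG t z)

variable [DecidableEq V]

theorem diagOut_leading_sum (d : Slot E → ℕ) (Y : ℕ → Slot E → ℕ → ℕ → ℝ) (N : ℕ) (k : V) :
    diagOut (leading d (∑ z ∈ Finset.range N, Y z)) k =
      ∑ z ∈ Finset.range N, diagOut (leading d (Y z)) k := by
  induction N with
  | zero => exact Matrix.blockDiagonal'_zero
  | succ N ih =>
    rw [Finset.sum_range_succ, Finset.sum_range_succ, ← ih]
    exact Matrix.blockDiagonal'_add _ _

theorem diagIn_leading_sum (d : Slot E → ℕ) (Y : ℕ → Slot E → ℕ → ℕ → ℝ) (N : ℕ) (k : V) :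
    diagIn (leading d (∑ z ∈ Finset.range N, Y z)) k =
      ∑ z ∈ Finset.range N, diagIn (leading d (Y z)) k := by
  induction N with
  | zero => exact Matrix.blockDiagonal'_zero
  | succ N ih =>
    rw [Finset.sum_range_succ, Finset.sum_range_succ, ← ih]
    exact Matrix.blockDiagonal'_add _ _

theorem diagOut_smul_one (d : Slot E → ℕ) (c : ℝ) (k : V) :
    diagOut (fun s => c • (1 : Matrix (Fin (d s)) (Fin (d s)) ℝ)) k = c • 1 :=
  (Matrix.blockDiagonal'_smul c _).trans (congrArg _ Matrix.blockDiagonal'_one)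

theorem diagIn_smul_one (d : Slot E → ℕ) (c : ℝ) (k : V) :
    diagIn (fun s => c • (1 : Matrix (Fin (d s)) (Fin (d s)) ℝ)) k = c • 1 :=
  (Matrix.blockDiagonal'_smul c _).trans (congrArg _ Matrix.blockDiagonal'_one)

variable [Fintype V]

theorem dotProduct_diagOut_mulVec_mono {d : Slot E → ℕ}
    {X Y : ∀ s, Matrix (Fin (d s)) (Fin (d s)) ℝ}
    (h : ∀ s v, v ⬝ᵥ (X s *ᵥ v) ≤ v ⬝ᵥ (Y s *ᵥ v)) (k : V) (v : OutIdx d k → ℝ) :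
    v ⬝ᵥ (diagOut X k *ᵥ v) ≤ v ⬝ᵥ (diagOut Y k *ᵥ v) := by
  rw [dotProduct_blockDiagonal'_mulVec, dotProduct_blockDiagonal'_mulVec]
  exact Finset.sum_le_sum fun s _ => h _ _

theorem dotProduct_diagIn_mulVec_mono {d : Slot E → ℕ}
    {X Y : ∀ s, Matrix (Fin (d s)) (Fin (d s)) ℝ}
    (h : ∀ s v, v ⬝ᵥ (X s *ᵥ v) ≤ v ⬝ᵥ (Y s *ᵥ v)) (k : V) (v : InIdx d k → ℝ) :
    v ⬝ᵥ (diagIn X k *ᵥ v) ≤ v ⬝ᵥ (diagIn Y k *ᵥ v) := by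
  rw [dotProduct_blockDiagonal'_mulVec, dotProduct_blockDiagonal'_mulVec]
  exact Finset.sum_le_sum fun s _ => h _ _

namespace Sys

variable {nu ny : ℕ → V → ℕ} {G : Sys E nu ny}

/-- The Lyapunov inequalities of a strongly stable eventually time-periodic system have an
eventually time-periodic solution: sum a given solution over sufficiently many periods. -/
theorem IsETP.exists_lyapunov {h q : ℕ} (hq : 0 < q) (hG : G.IsETP h q) (hs : G.StronglyStable) :
    ∃ ε : ℝ, 0 < ε ∧ ∃ b : ℝ, ∃ Y : ℕ → Slot E → ℕ → ℕ → ℝ, DistSys.IsETP h q Y ∧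
      (∀ t s, (leading (G.n t) (Y t) s).PosDef) ∧
      (∀ t s v, v ⬝ᵥ (leading (G.n t) (Y t) s *ᵥ v) ≤ b * (v ⬝ᵥ v)) ∧
      ∀ t k v, (G.A t k *ᵥ v) ⬝ᵥ (diagOut (leading (G.n (t + 1)) (Y (t + 1))) k *ᵥ (G.A t k *ᵥ v))
        + ε * (v ⬝ᵥ v) ≤ v ⬝ᵥ (diagIn (leading (G.n t) (Y t)) k *ᵥ v) := by
  obtain ⟨β, hβ, X, ⟨hlo, c₀, hhi⟩, hL⟩ := hs
  set c := max c₀ 1 with hc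
  have hc0 : 0 < c := by positivity
  -- Padding by zeros lets values of `X` at different times, whose dimensions agree only
  -- propositionally, be added; `leading` cuts the sum back to size.
  set Xe := X.extend with hXe
  have hherm : ∀ t s, (X t s).IsHermitian := fun t s => by
    have h1 := (hlo t s).isHermitian.add
      ((Matrix.isHermitian_one (n := Fin (G.n t s)) (α := ℝ)).smul (IsSelfAdjoint.all β))
    rwa [sub_add_cancel] at h1
  have hsym : ∀ t s a b, Xe t s a b = Xe t s b a := fun t s a b => by
    simp only [hXe, Family.extend]
    by_cases hab : a < G.n t s ∧ b < G.n t s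
    · rw [dif_pos hab, dif_pos hab.symm]
      exact ((hherm t s).apply _ _).symm
    · rw [dif_neg hab, dif_neg fun h => hab h.symm]
  have hle : ∀ t' (d : Slot E → ℕ), G.n t' = d → ∀ s v,
      β * (v ⬝ᵥ v) ≤ v ⬝ᵥ (leading d (Xe t') s *ᵥ v) ∧
      v ⬝ᵥ (leading d (Xe t') s *ᵥ v) ≤ c * (v ⬝ᵥ v) := by
    rintro t' d rfl s v
    rw [Family.leading_extend]
    have h1 := (hlo t' s).dotProduct_le v
    have h2 := (hhi t' s).dotProduct_le v
    rw [dotProduct_smul_one_mulVec] at h1 h2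
    exact ⟨h1, h2.trans (mul_le_mul_of_nonneg_right (le_max_left _ _) (dotProduct_self_nonneg v))⟩
  have hloOut : ∀ t' (d : Slot E → ℕ), G.n t' = d → ∀ k (v : OutIdx d k → ℝ),
      β * (v ⬝ᵥ v) ≤ v ⬝ᵥ (diagOut (leading d (Xe t')) k *ᵥ v) := fun t' d hd k v => by
    rw [← dotProduct_smul_one_mulVec, ← diagOut_smul_one]
    exact dotProduct_diagOut_mulVec_mono (fun s v => by
      rw [dotProduct_smul_one_mulVec]; exact (hle t' d hd s v).1) k v
  have hhiOut : ∀ t' (d : Slot E → ℕ), G.n t' = d → ∀ k (v : OutIdx d k → ℝ),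
      v ⬝ᵥ (diagOut (leading d (Xe t')) k *ᵥ v) ≤ c * (v ⬝ᵥ v) := fun t' d hd k v => by
    rw [← dotProduct_smul_one_mulVec, ← diagOut_smul_one]
    exact dotProduct_diagOut_mulVec_mono (fun s v => by
      rw [dotProduct_smul_one_mulVec]; exact (hle t' d hd s v).2) k v
  have hhiIn : ∀ t' (d : Slot E → ℕ), G.n t' = d → ∀ k (v : InIdx d k → ℝ),
      v ⬝ᵥ (diagIn (leading d (Xe t')) k *ᵥ v) ≤ c * (v ⬝ᵥ v) := fun t' d hd k v => by
    rw [← dotProduct_smul_one_mulVec, ← diagIn_smul_one]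
    exact dotProduct_diagIn_mulVec_mono (fun s v => by
      rw [dotProduct_smul_one_mulVec]; exact (hle t' d hd s v).2) k v
  have hlyap : ∀ t t', (⟨(G.n (t' + 1), G.n t', nu t', ny t'), (G.A t', G.B t', G.C t', G.D t')⟩ :
      Σ d : (Slot E → ℕ) × (Slot E → ℕ) × (V → ℕ) × (V → ℕ),
        (∀ k, Matrix (OutIdx d.1 k) (InIdx d.2.1 k) ℝ) ×
        (∀ k, Matrix (OutIdx d.1 k) (Fin (d.2.2.1 k)) ℝ) ×
        (∀ k, Matrix (Fin (d.2.2.2 k)) (InIdx d.2.1 k) ℝ) ×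
        (∀ k, Matrix (Fin (d.2.2.2 k)) (Fin (d.2.2.1 k)) ℝ)) =
      ⟨(G.n (t + 1), G.n t, nu t, ny t), (G.A t, G.B t, G.C t, G.D t)⟩ → ∀ k v,
      (G.A t k *ᵥ v) ⬝ᵥ (diagOut (leading (G.n (t + 1)) (Xe (t' + 1))) k *ᵥ (G.A t k *ᵥ v))
        + β * (v ⬝ᵥ v) ≤ v ⬝ᵥ (diagIn (leading (G.n t) (Xe t')) k *ᵥ v) := by
    intro t t' e
    have base : ∀ k v,
        (G.A t' k *ᵥ v) ⬝ᵥ (diagOut (leading (G.n (t' + 1)) (Xe (t' + 1))) k *ᵥ (G.A t' k *ᵥ v))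
        + β * (v ⬝ᵥ v) ≤ v ⬝ᵥ (diagIn (leading (G.n t') (Xe t')) k *ᵥ v) := fun k v => by
      have h1 := (hL t' k).dotProduct_le v
      rw [Matrix.sub_mulVec, dotProduct_sub, dotProduct_congruence_mulVec, Matrix.neg_mulVec,
        dotProduct_neg, dotProduct_smul_one_mulVec] at h1
      rw [hXe, Family.leading_extend, Family.leading_extend]
      linarith
    have key : ∀ a b : (Σ d : (Slot E → ℕ) × (Slot E → ℕ) × (V → ℕ) × (V → ℕ),
        (∀ k, Matrix (OutIdx d.1 k) (InIdx d.2.1 k) ℝ) ×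
        (∀ k, Matrix (OutIdx d.1 k) (Fin (d.2.2.1 k)) ℝ) ×
        (∀ k, Matrix (Fin (d.2.2.2 k)) (InIdx d.2.1 k) ℝ) ×
        (∀ k, Matrix (Fin (d.2.2.2 k)) (Fin (d.2.2.1 k)) ℝ)), a = b →
        (∀ k v, (a.2.1 k *ᵥ v) ⬝ᵥ (diagOut (leading a.1.1 (Xe (t' + 1))) k *ᵥ (a.2.1 k *ᵥ v))
          + β * (v ⬝ᵥ v) ≤ v ⬝ᵥ (diagIn (leading a.1.2.1 (Xe t')) k *ᵥ v)) →
        (∀ k v, (b.2.1 k *ᵥ v) ⬝ᵥ (diagOut (leading b.1.1 (Xe (t' + 1))) k *ᵥ (b.2.1 k *ᵥ v))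
          + β * (v ⬝ᵥ v) ≤ v ⬝ᵥ (diagIn (leading b.1.2.1 (Xe t')) k *ᵥ v)) := by
      rintro a b rfl
      exact id
    exact key _ _ e base
  -- With this choice `N β ≥ c² / β + β`: the first summand pays for the boundary term at the
  -- wrap-around, the second is the remaining margin.
  obtain ⟨N, hN⟩ := exists_nat_ge (c * c / (β * β) + 1)
  have hN1 : (1 : ℝ) ≤ N := le_trans (by have : 0 ≤ c * c / (β * β) := by positivity
                                         linarith) hN
  have hN0 : 0 < N := by exact_mod_cast (zero_lt_one.trans_le hN1)
  have hNβ : c * c / β + β ≤ N * β := by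
    have := mul_le_mul_of_nonneg_right hN hβ.le
    have e : (c * c / (β * β) + 1) * β = c * c / β + β := by field_simp
    rwa [e] at this
  -- Chosen so that `κ β = N c`: at the junction the sum over periods, at most `N c`, is dominated
  -- by `κ X`, at least `κ β`.
  set κ : ℝ := N * c / β with hκ
  have hκβ : κ * β = N * c := div_mul_cancel₀ _ hβ.ne'
  have hκ0 : 0 < κ := by positivity
  set W : ℕ → Slot E → ℕ → ℕ → ℝ := fun j => ∑ z ∈ Finset.range N, Xe (h + j + z * q) with hW
  set Y : ℕ → Slot E → ℕ → ℕ → ℝ := fun t => if t < h then κ • Xe t else W ((t - h) % q) with hY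
  have hYlt : ∀ t, t < h → Y t = κ • Xe t := fun t ht => if_pos ht
  have hYge : ∀ t, h ≤ t → Y t = W ((t - h) % q) := fun t ht => if_neg (not_lt.2 ht)
  have hn := hG.dim
  have hWquad : ∀ t s v, h ≤ t → v ⬝ᵥ (leading (G.n t) (W ((t - h) % q)) s *ᵥ v) =
      ∑ z ∈ Finset.range N,
        v ⬝ᵥ (leading (G.n t) (Xe (h + (t - h) % q + z * q)) s *ᵥ v) := fun t s v ht => by
    rw [hW, leading_sum, Matrix.sum_mulVec, dotProduct_sum]
  have hWle : ∀ t s v, h ≤ t →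
      v ⬝ᵥ (leading (G.n t) (W ((t - h) % q)) s *ᵥ v) ≤ N * c * (v ⬝ᵥ v) := fun t s v ht => by
    rw [hWquad t s v ht]
    refine (Finset.sum_le_card_nsmul _ _ (c * (v ⬝ᵥ v)) fun z _ =>
      (hle _ _ (hn.apply_mod ht z) s v).2).trans_eq ?_
    rw [Finset.card_range, nsmul_eq_mul, mul_assoc]
  have hWge : ∀ t s v, h ≤ t →
      N * β * (v ⬝ᵥ v) ≤ v ⬝ᵥ (leading (G.n t) (W ((t - h) % q)) s *ᵥ v) := fun t s v ht => by
    rw [hWquad t s v ht]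
    refine Eq.trans_le ?_ (Finset.card_nsmul_le_sum _ _ (β * (v ⬝ᵥ v)) fun z _ =>
      (hle _ _ (hn.apply_mod ht z) s v).1)
    rw [Finset.card_range, nsmul_eq_mul, mul_assoc]
  refine ⟨min (κ * β) β, lt_min (by positivity) hβ, max (κ * c) (N * c), Y, ?_, ?_, ?_, ?_⟩
  · intro t z
    rw [hYge _ (by omega), hYge _ (by omega)]
    congr 1
    rw [show t + h + z * q - h = t + z * q by omega, show t + h - h = t by omega,
      Nat.add_mul_mod_self_right]
  · intro t s
    refine .of_dotProduct_mulVec_pos (isHermitian_leading (fun s a b => ?_) _ _) fun v hv => ?_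
    · simp only [hY, hW]
      split_ifs
      · simp only [Pi.smul_apply, hsym t s a b]
      · simp only [Finset.sum_apply, hsym _ s a b]
    · rw [star_trivial]
      have hv' := dotProduct_self_pos hv
      by_cases ht : t < h
      · rw [hYlt t ht, leading_smul, Matrix.smul_mulVec, dotProduct_smul, smul_eq_mul]
        exact mul_pos hκ0 ((by positivity : 0 < β * (v ⬝ᵥ v)).trans_le (hle t _ rfl s v).1)
      · rw [hYge t (not_lt.1 ht)]
        exact (by positivity : 0 < N * β * (v ⬝ᵥ v)).trans_le (hWge t s v (not_lt.1 ht))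
  · intro t s v
    have hv' := dotProduct_self_nonneg v
    by_cases ht : t < h
    · rw [hYlt t ht, leading_smul, Matrix.smul_mulVec, dotProduct_smul, smul_eq_mul]
      have h1 := mul_le_mul_of_nonneg_left (hle t _ rfl s v).2 hκ0.le
      have h2 := mul_le_mul_of_nonneg_right (le_max_left (κ * c) (N * c)) hv'
      linarith
    · rw [hYge t (not_lt.1 ht)]
      exact (hWle t s v (not_lt.1 ht)).trans
        (mul_le_mul_of_nonneg_right (le_max_right (κ * c) (N * c)) hv')
  · intro t k v
    have hv' := dotProduct_self_nonneg v
    by_cases ht : t < h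
    · have h1 := mul_le_mul_of_nonneg_left (hlyap t t rfl k v) hκ0.le
      have h2 := mul_le_mul_of_nonneg_right (min_le_left (κ * β) β) hv'
      have h3 : v ⬝ᵥ (diagIn (leading (G.n t) (Y t)) k *ᵥ v) =
          κ * (v ⬝ᵥ (diagIn (leading (G.n t) (Xe t)) k *ᵥ v)) := by
        rw [hYlt t ht]
        have e : diagIn (leading (G.n t) (κ • Xe t)) k = κ • diagIn (leading (G.n t) (Xe t)) k :=
          Matrix.blockDiagonal'_smul κ _
        rw [e, Matrix.smul_mulVec, dotProduct_smul, smul_eq_mul]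
      have h4 : (G.A t k *ᵥ v) ⬝ᵥ
          (diagOut (leading (G.n (t + 1)) (Y (t + 1))) k *ᵥ (G.A t k *ᵥ v)) ≤ κ *
          ((G.A t k *ᵥ v) ⬝ᵥ (diagOut (leading (G.n (t + 1)) (Xe (t + 1))) k *ᵥ
            (G.A t k *ᵥ v))) := by
        have e : diagOut (leading (G.n (t + 1)) (κ • Xe (t + 1))) k =
          κ • diagOut (leading (G.n (t + 1)) (Xe (t + 1))) k := Matrix.blockDiagonal'_smul κ _
        rw [← smul_eq_mul κ, ← dotProduct_smul, ← Matrix.smul_mulVec, ← e]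
        refine dotProduct_diagOut_mulVec_mono (fun s w => ?_) k _
        by_cases ht' : t + 1 < h
        · rw [hYlt _ ht']
        · rw [hYge _ (not_lt.1 ht'), leading_smul, Matrix.smul_mulVec, dotProduct_smul, smul_eq_mul]
          have h5 := mul_le_mul_of_nonneg_left (hle (t + 1) _ rfl s w).1 hκ0.le
          rw [← mul_assoc, hκβ] at h5
          exact (hWle _ s w (not_lt.1 ht')).trans h5
      rw [h3]
      linarith
    · rw [not_lt] at ht
      set j := (t - h) % q with hj
      have hjq : j < q := Nat.mod_lt _ hq
      set w := G.A t k *ᵥ v with hw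
      -- The Lyapunov inequality is added over the `N` copies of time `t`, for a total margin of `N
      -- β`.
      have hsum := Finset.sum_le_sum fun z (_ : z ∈ Finset.range N) =>
        hlyap t _ (DistSys.IsETP.apply_mod hG ht z) k v
      have h0 := hlyap t _ (DistSys.IsETP.apply_mod hG ht 0) k v
      rw [← hj, ← hw] at h0
      have hdim1 : ∀ z, G.n (h + j + z * q + 1) = G.n (t + 1) := fun z =>
        congrArg (fun a => a.1.1) (DistSys.IsETP.apply_mod hG ht z)
      have h1 := hloOut _ _ (hdim1 0) k w
      have h2 := hhiIn _ _ (hn.apply_mod ht 0) k v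
      rw [← hj] at h2
      have h3 : v ⬝ᵥ (diagIn (leading (G.n t) (Y t)) k *ᵥ v) = ∑ z ∈ Finset.range N,
          v ⬝ᵥ (diagIn (leading (G.n t) (Xe (h + j + z * q))) k *ᵥ v) := by
        rw [hYge t ht, ← hj]
        simp only [hW]
        rw [diagIn_leading_sum, Matrix.sum_mulVec, dotProduct_sum]
      have h4 : w ⬝ᵥ (diagOut (leading (G.n (t + 1)) (Y (t + 1))) k *ᵥ w) ≤
          ∑ z ∈ Finset.range N,
            w ⬝ᵥ (diagOut (leading (G.n (t + 1)) (Xe (h + j + z * q + 1))) k *ᵥ w) +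
          c * (w ⬝ᵥ w) := by
        have hw' := dotProduct_self_nonneg w
        rw [hYge (t + 1) (by omega)]
        simp only [hW]
        rw [diagOut_leading_sum, Matrix.sum_mulVec, dotProduct_sum]
        by_cases hj1 : j + 1 < q
        · have e : (t + 1 - h) % q = j + 1 := by
            rw [show t + 1 - h = (t - h) + 1 by omega, Nat.add_mod, ← hj]
            rw [Nat.mod_eq_of_lt (show 1 < q by omega), Nat.mod_eq_of_lt hj1]
          rw [e]
          have e2 : ∀ z, h + (j + 1) + z * q = h + j + z * q + 1 := fun z => by ring
          simp only [e2]
          have : 0 ≤ c * (w ⬝ᵥ w) := by positivity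
          linarith
        -- Wrap-around: the inequalities provide the periods `1, …, N`, whereas `Y (t + 1)` sums the
        -- periods `0, …, N - 1`. The extra term for period `0` is at most `c |w|²`, and the surplus
        -- term for period `N` is nonnegative.
        · have e : (t + 1 - h) % q = 0 := by
            have hjq' : j + 1 = q := by omega
            rw [show t + 1 - h = (t - h) + 1 by omega, ← Nat.mod_add_mod, ← hj, hjq',
              Nat.mod_self]
          have e2 : ∀ z, h + j + z * q + 1 = h + 0 + (z + 1) * q := fun z => by
            have hjq' : j + 1 = q := by omega
            rw [add_mul, one_mul, ← hjq']
            ring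
          rw [e]
          simp only [e2]
          have hdim : ∀ z, G.n (h + 0 + (z + 1) * q) = G.n (t + 1) := fun z => e2 z ▸ hdim1 z
          have hdim0 : G.n (h + 0 + 0 * q) = G.n (t + 1) := by
            rw [← hdim 0]
            have := hn 0 1
            rw [show 0 + h + 1 * q = h + 0 + (0 + 1) * q by ring] at this
            rw [this]
            congr 1
            ring
          have h5 := Finset.sum_range_succ' (fun z =>
            w ⬝ᵥ (diagOut (leading (G.n (t + 1)) (Xe (h + 0 + z * q))) k *ᵥ w)) N
          rw [Finset.sum_range_succ] at h5
          have h6 := hhiOut _ _ hdim0 k w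
          have h7 : 0 ≤ w ⬝ᵥ (diagOut (leading (G.n (t + 1)) (Xe (h + 0 + N * q))) k *ᵥ w) := by
            obtain ⟨M, rfl⟩ : ∃ M, N = M + 1 := ⟨N - 1, by omega⟩
            exact (by positivity : 0 ≤ β * (w ⬝ᵥ w)).trans (hloOut _ _ (hdim M) k w)
          linarith
      rw [Finset.sum_add_distrib, Finset.sum_const, Finset.card_range, nsmul_eq_mul] at hsum
      have h5 := mul_le_mul_of_nonneg_right (min_le_right (κ * β) β) hv'
      -- The single inequality for the copy `z = 0` bounds `β |w|²` by `c |v|²`, so the boundary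
      -- term is controlled by `v`.
      have h6 : c * (w ⬝ᵥ w) ≤ c * c / β * (v ⬝ᵥ v) := by
        have : β * (w ⬝ᵥ w) ≤ c * (v ⬝ᵥ v) := by nlinarith
        have := mul_le_mul_of_nonneg_left this (by positivity : 0 ≤ c / β)
        have e1 : c / β * (β * (w ⬝ᵥ w)) = c * (w ⬝ᵥ w) := by field_simp
        have e2 : c / β * (c * (v ⬝ᵥ v)) = c * c / β * (v ⬝ᵥ v) := by ring
        linarith
      have h7 := mul_le_mul_of_nonneg_right hNβ hv'
      rw [h3]
      linarith

end Sys

end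

/-! ### Contractive coordinates and existence of a balanced realization. -/

section

theorem IsETP.exists_le {h q : ℕ} (hq : 0 < q) {f : ℕ → ℝ} (hf : IsETP h q f) :
    ∃ b, ∀ t, f t ≤ b := by
  obtain ⟨b, hb⟩ := ((Finset.range (h + q)).image f).exists_le
  refine ⟨b, fun t => ?_⟩
  obtain ⟨t', ht', e⟩ := hf.exists_lt hq t
  exact e ▸ hb _ (Finset.mem_image_of_mem f (Finset.mem_range.2 ht'))

section Matrices

variable {ι κ : Type*} [Fintype ι] [Fintype κ]

theorem dotProduct_mulVec_self_le (M : Matrix κ ι ℝ) (v : ι → ℝ) :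
    (M *ᵥ v) ⬝ᵥ (M *ᵥ v) ≤ (∑ i, ∑ j, M i j ^ 2) * (v ⬝ᵥ v) := by
  rw [dotProduct, Finset.sum_mul]
  refine Finset.sum_le_sum fun i _ => ?_
  have := Finset.sum_mul_sq_le_sq_mul_sq Finset.univ (M i) v
  simpa only [Matrix.mulVec, dotProduct, sq] using this

/-- The transpose of a contraction is a contraction. -/
theorem dotProduct_transpose_mulVec_le {A : Matrix κ ι ℝ} {a : ℝ} (ha : 0 < a)
    (hA : ∀ v, (A *ᵥ v) ⬝ᵥ (A *ᵥ v) ≤ a * (v ⬝ᵥ v)) (w : κ → ℝ) :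
    (Aᵀ *ᵥ w) ⬝ᵥ (Aᵀ *ᵥ w) ≤ a * (w ⬝ᵥ w) := by
  have h1 := hA (Aᵀ *ᵥ w)
  -- Expanding `0 ≤ |A Aᵀ w - a w|²` and bounding `|A Aᵀ w|²` by `a |Aᵀ w|²` leaves the claim
  -- multiplied by `a`.
  have h2 := dotProduct_self_nonneg (A *ᵥ (Aᵀ *ᵥ w) - a • w)
  have h3 : (Aᵀ *ᵥ w) ⬝ᵥ (Aᵀ *ᵥ w) = w ⬝ᵥ (A *ᵥ (Aᵀ *ᵥ w)) := by
    rw [Matrix.dotProduct_mulVec w, ← Matrix.mulVec_transpose]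
  rw [sub_dotProduct, dotProduct_sub, dotProduct_sub, smul_dotProduct, dotProduct_smul,
    smul_dotProduct, dotProduct_smul, dotProduct_comm _ w, ← h3] at h2
  simp only [smul_eq_mul] at h2
  have h4 : a * ((Aᵀ *ᵥ w) ⬝ᵥ (Aᵀ *ᵥ w)) ≤ a * (a * (w ⬝ᵥ w)) := by linarith
  exact le_of_mul_le_mul_left h4 ha

theorem isHermitian_smul_one {n : Type*} [DecidableEq n] (r : ℝ) :
    (r • (1 : Matrix n n ℝ)).IsHermitian :=
  Matrix.isHermitian_one.smul (IsSelfAdjoint.all r)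

/-- A strict contraction satisfies a Lyapunov inequality with a multiple of the identity. -/
theorem slt_lyapunov_smul_one {μ : Type*} [Fintype μ] [DecidableEq ι] [DecidableEq κ]
    {A : Matrix κ ι ℝ} {B : Matrix μ ι ℝ} {δ b c : ℝ}
    (hA : ∀ v, (A *ᵥ v) ⬝ᵥ (A *ᵥ v) ≤ (1 - δ) * (v ⬝ᵥ v))
    (hB : ∀ v, (B *ᵥ v) ⬝ᵥ (B *ᵥ v) ≤ b * (v ⬝ᵥ v)) (hc0 : 0 < c) (hc : c * δ = b + 1) :
    SLt (Aᵀ * (c • (1 : Matrix κ κ ℝ)) * A - c • (1 : Matrix ι ι ℝ) + Bᵀ * B)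
      (-((1 / 2 : ℝ) • 1)) := by
  refine .of_dotProduct_lt (((?_ : Matrix.IsHermitian _).sub (isHermitian_smul_one c)).add ?_)
    (isHermitian_smul_one _).neg
    fun v hv => ?_
  · simpa only [Matrix.conjTranspose_eq_transpose_of_trivial] using
      Matrix.isHermitian_conjTranspose_mul_mul A (isHermitian_smul_one c)
  · simpa only [Matrix.conjTranspose_eq_transpose_of_trivial] using
      Matrix.isHermitian_conjTranspose_mul_self B
  · have hB' : v ⬝ᵥ ((Bᵀ * B) *ᵥ v) = (B *ᵥ v) ⬝ᵥ (B *ᵥ v) := by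
      rw [← Matrix.mulVec_mulVec, Matrix.dotProduct_mulVec, Matrix.vecMul_transpose]
    rw [Matrix.add_mulVec, Matrix.sub_mulVec, dotProduct_add, dotProduct_sub,
      dotProduct_congruence_mulVec, Matrix.neg_mulVec, dotProduct_neg, dotProduct_smul_one_mulVec,
      dotProduct_smul_one_mulVec, dotProduct_smul_one_mulVec, hB']
    have h1 := dotProduct_self_pos hv
    have h2 := mul_le_mul_of_nonneg_left (hA v) hc0.le
    have h3 := hB v
    have h4 : c * ((1 - δ) * (v ⬝ᵥ v)) = c * (v ⬝ᵥ v) - (b + 1) * (v ⬝ᵥ v) := by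
      rw [← hc]; ring
    -- The left side is at most `(-c δ + b) |v|² = -|v|²`, strictly below `-|v|² / 2`.
    nlinarith

end Matrices

variable {V : Type*} {E : Finset (V × V)}

/-- An invertible `T` with `TᵀT = M` (and `1` if `M` is not positive definite). -/
noncomputable def factor {d : ℕ} (M : Matrix (Fin d) (Fin d) ℝ) : Matrix (Fin d) (Fin d) ℝ :=
  open Classical in
  if h : M.PosDef then (exists_transpose_mul_self h).choose else 1

theorem isUnit_factor {d : ℕ} {M : Matrix (Fin d) (Fin d) ℝ} (h : M.PosDef) :
    IsUnit (factor M) := by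
  rw [factor, dif_pos h]
  exact (exists_transpose_mul_self h).choose_spec.1

theorem factor_transpose_mul_self {d : ℕ} {M : Matrix (Fin d) (Fin d) ℝ} (h : M.PosDef) :
    (factor M)ᵀ * factor M = M := by
  rw [factor, dif_pos h]
  exact (exists_transpose_mul_self h).choose_spec.2

variable [Fintype V] [DecidableEq V]

theorem dotProduct_diagOut_mulVec_self {d : Slot E → ℕ}
    (T : ∀ s, Matrix (Fin (d s)) (Fin (d s)) ℝ) (k : V) (v : OutIdx d k → ℝ) :
    (diagOut T k *ᵥ v) ⬝ᵥ (diagOut T k *ᵥ v) =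
      v ⬝ᵥ (diagOut (fun s => (T s)ᵀ * T s) k *ᵥ v) := by
  have e : diagOut (fun s => (T s)ᵀ * T s) k = (diagOut T k)ᵀ * diagOut T k := by
    rw [diagOut, Matrix.blockDiagonal'_mul, diagOut, Matrix.blockDiagonal'_transpose]
  rw [e, ← Matrix.mulVec_mulVec, Matrix.dotProduct_mulVec v, Matrix.vecMul_transpose]

theorem dotProduct_diagIn_mulVec_self {d : Slot E → ℕ}
    (T : ∀ s, Matrix (Fin (d s)) (Fin (d s)) ℝ) (k : V) (v : InIdx d k → ℝ) :
    (diagIn T k *ᵥ v) ⬝ᵥ (diagIn T k *ᵥ v) =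
      v ⬝ᵥ (diagIn (fun s => (T s)ᵀ * T s) k *ᵥ v) := by
  have e : diagIn (fun s => (T s)ᵀ * T s) k = (diagIn T k)ᵀ * diagIn T k := by
    rw [diagIn, Matrix.blockDiagonal'_mul, diagIn, Matrix.blockDiagonal'_transpose]
  rw [e, ← Matrix.mulVec_mulVec, Matrix.dotProduct_mulVec v, Matrix.vecMul_transpose]

theorem diagIn_mul_diagIn_inv {d : Slot E → ℕ} {T : ∀ s, Matrix (Fin (d s)) (Fin (d s)) ℝ}
    (hT : ∀ s, IsUnit (T s)) (k : V) : diagIn T k * diagIn (fun s => (T s)⁻¹) k = 1 := by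
  rw [diagIn, diagIn, ← Matrix.blockDiagonal'_mul, ← Matrix.blockDiagonal'_one]
  exact congrArg _ (funext fun s =>
    Matrix.mul_nonsing_inv _ ((Matrix.isUnit_iff_isUnit_det _).1 (hT s.1)))

namespace Sys

variable {nu ny : ℕ → V → ℕ} {G : Sys E nu ny} {T : Family G.n}

theorem diagIn_inv_mulVec {t : ℕ} (hT : ∀ s, IsUnit (T t s)) (k : V)
    (x : ∀ s, Fin (G.n t s) → ℝ) :
    (diagIn (fun s => (T t s)⁻¹) k *ᵥ fun p : InIdx (G.n t) k => (T t p.1.1 *ᵥ x p.1.1) p.2) =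
      fun p => x p.1.1 p.2 := by
  funext p
  rw [blockDiagonal'_mulVec]
  have h : (T t p.1.1)⁻¹ *ᵥ (T t p.1.1 *ᵥ x p.1.1) = x p.1.1 := by
    rw [Matrix.mulVec_mulVec, Matrix.nonsing_inv_mul _
      ((Matrix.isUnit_iff_isUnit_det _).1 (hT p.1.1)), Matrix.one_mulVec]
  exact congrFun h p.2

theorem state_transform (hT : ∀ t s, IsUnit (T t s)) (u : Signal nu) (t : ℕ) :
    (G.transform T).state u t = fun s => T t s *ᵥ G.state u t s := by
  induction t with
  | zero =>
    funext s
    exact (Matrix.mulVec_zero (T 0 s)).symm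
  | succ t ih =>
    funext s i
    have h1 : (diagOut (T (t + 1)) s.tail * G.A t s.tail * diagIn (fun s => (T t s)⁻¹) s.tail) *ᵥ
        (fun p => (T t p.1.1 *ᵥ G.state u t p.1.1) p.2) =
        diagOut (T (t + 1)) s.tail *ᵥ (G.A t s.tail *ᵥ fun p => G.state u t p.1.1 p.2) := by
      rw [← Matrix.mulVec_mulVec, diagIn_inv_mulVec (hT t), ← Matrix.mulVec_mulVec]
    have h2 := Matrix.mulVec_mulVec (u t s.tail) (diagOut (T (t + 1)) s.tail) (G.B t s.tail)
    have h3 := congrArg₂ (· + ·) h1 h2.symm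
    rw [← Matrix.mulVec_add] at h3
    replace h3 := (congrFun h3 ⟨⟨s, rfl⟩, i⟩).trans (blockDiagonal'_mulVec _ _ _)
    exact (congrArg (fun X : ∀ s, Fin (G.n t s) → ℝ =>
      ((diagOut (T (t + 1)) s.tail * G.A t s.tail * diagIn (fun s => (T t s)⁻¹) s.tail) *ᵥ
        (fun p => X p.1.1 p.2) + (diagOut (T (t + 1)) s.tail * G.B t s.tail) *ᵥ u t s.tail)
        ⟨⟨s, rfl⟩, i⟩) ih).trans h3

theorem output_transform (hT : ∀ t s, IsUnit (T t s)) (u : Signal nu) :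
    (G.transform T).output u = G.output u := by
  funext t k
  have h1 : (G.C t k * diagIn (fun s => (T t s)⁻¹) k) *ᵥ
      (fun p => (T t p.1.1 *ᵥ G.state u t p.1.1) p.2) =
      G.C t k *ᵥ fun p => G.state u t p.1.1 p.2 := by
    rw [← Matrix.mulVec_mulVec, diagIn_inv_mulVec (hT t)]
  exact congrArg (· + G.D t k *ᵥ u t k) ((congrArg (fun X : ∀ s, Fin (G.n t s) → ℝ =>
    (G.C t k * diagIn (fun s => (T t s)⁻¹) k) *ᵥ fun p => X p.1.1 p.2)
    (state_transform hT u t)).trans h1)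

/-- Although `factor` uses choice, it is a function of the matrix alone, so equal matrices at
different times receive equal factors and periodicity survives. -/
theorem IsETP.transform_leading {h q : ℕ} (hG : G.IsETP h q) {Y : ℕ → Slot E → ℕ → ℕ → ℝ}
    (hY : DistSys.IsETP h q Y) :
    (G.transform fun t s => factor (leading (G.n t) (Y t) s)).IsETP h q := fun t z =>
  congrArg (fun a : (Σ d : (Slot E → ℕ) × (Slot E → ℕ) × (V → ℕ) × (V → ℕ),
        (∀ k, Matrix (OutIdx d.1 k) (InIdx d.2.1 k) ℝ) ×
        (∀ k, Matrix (OutIdx d.1 k) (Fin (d.2.2.1 k)) ℝ) ×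
        (∀ k, Matrix (Fin (d.2.2.2 k)) (InIdx d.2.1 k) ℝ) ×
        (∀ k, Matrix (Fin (d.2.2.2 k)) (Fin (d.2.2.1 k)) ℝ)) ×
        (Slot E → ℕ → ℕ → ℝ) × (Slot E → ℕ → ℕ → ℝ) =>
      (⟨a.1.1, (fun k => diagOut (fun s => factor (leading a.1.1.1 a.2.1 s)) k * a.1.2.1 k *
          diagIn (fun s => (factor (leading a.1.1.2.1 a.2.2 s))⁻¹) k,
        fun k => diagOut (fun s => factor (leading a.1.1.1 a.2.1 s)) k * a.1.2.2.1 k,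
        fun k => a.1.2.2.2.1 k * diagIn (fun s => (factor (leading a.1.1.2.1 a.2.2 s))⁻¹) k,
        a.1.2.2.2.2)⟩ : Σ d : (Slot E → ℕ) × (Slot E → ℕ) × (V → ℕ) × (V → ℕ),
        (∀ k, Matrix (OutIdx d.1 k) (InIdx d.2.1 k) ℝ) ×
        (∀ k, Matrix (OutIdx d.1 k) (Fin (d.2.2.1 k)) ℝ) ×
        (∀ k, Matrix (Fin (d.2.2.2 k)) (InIdx d.2.1 k) ℝ) ×
        (∀ k, Matrix (Fin (d.2.2.2 k)) (Fin (d.2.2.1 k)) ℝ)))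
    (DistSys.IsETP.prodMk hG (hY.succ.prodMk hY) t z)

/-- A strongly stable eventually time-periodic system can be scaled so that the state update is
uniformly contractive. -/
theorem IsETP.exists_transform_contractive {h q : ℕ} (hq : 0 < q) (hG : G.IsETP h q)
    (hs : G.StronglyStable) :
    ∃ T : Family G.n, (∀ t s, IsUnit (T t s)) ∧ T.IsETP h q ∧ (G.transform T).IsETP h q ∧
      ∃ δ : ℝ, 0 < δ ∧ δ < 1 ∧ ∀ t k v, ((G.transform T).A t k *ᵥ v) ⬝ᵥ
        ((G.transform T).A t k *ᵥ v) ≤ (1 - δ) * (v ⬝ᵥ v) := by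
  obtain ⟨ε, hε, b₀, Y, hYE, hYpos, hYb, hL⟩ := hG.exists_lyapunov hq hs
  -- The bound `2 * ε` forces `ε / b ≤ 1 / 2`. In the new coordinates `|w|²` is the Lyapunov form of
  -- `v`, at most `b |v|²`, so the decrease `ε |v|²` is at least `(ε / b) |w|²`.
  set b := max b₀ (2 * ε) with hb
  have hb0 : 0 < b := lt_of_lt_of_le (by positivity) (le_max_right _ _)
  refine ⟨fun t s => factor (leading (G.n t) (Y t) s), fun t s => isUnit_factor (hYpos t s),
    fun t z => ?_, hG.transform_leading hYE, ε / b, by positivity, ?_, fun t k => ?_⟩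
  · exact congrArg (fun a : (Slot E → ℕ) × (Slot E → ℕ → ℕ → ℝ) =>
      (⟨a.1, fun s => factor (leading a.1 a.2 s)⟩ :
        Σ d : Slot E → ℕ, ∀ s, Matrix (Fin (d s)) (Fin (d s)) ℝ)) (hG.dim.prodMk hYE t z)
  · rw [div_lt_one hb0]
    exact lt_of_lt_of_le (by linarith) (le_max_right _ _)
  · suffices H : ∀ w : InIdx (G.n t) k → ℝ, ∀ w', w' =
        (diagOut (fun s => factor (leading (G.n (t + 1)) (Y (t + 1)) s)) k * G.A t k *
          diagIn (fun s => (factor (leading (G.n t) (Y t) s))⁻¹) k) *ᵥ w →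
        w' ⬝ᵥ w' ≤ (1 - ε / b) * (w ⬝ᵥ w) from fun w => H w _ rfl
    intro w w' hw'
    set v := diagIn (fun s => (factor (leading (G.n t) (Y t) s))⁻¹) k *ᵥ w with hv
    have h1 : w' =
        diagOut (fun s => factor (leading (G.n (t + 1)) (Y (t + 1)) s)) k *ᵥ (G.A t k *ᵥ v) := by
      rw [hw', hv, Matrix.mulVec_mulVec, Matrix.mulVec_mulVec]
    have h2 : w = diagIn (fun s => factor (leading (G.n t) (Y t) s)) k *ᵥ v := by
      rw [hv, Matrix.mulVec_mulVec, diagIn_mul_diagIn_inv fun s => isUnit_factor (hYpos t s),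
        Matrix.one_mulVec]
    have e1 : (fun s => (factor (leading (G.n (t + 1)) (Y (t + 1)) s))ᵀ *
        factor (leading (G.n (t + 1)) (Y (t + 1)) s)) = leading (G.n (t + 1)) (Y (t + 1)) :=
      funext fun s => factor_transpose_mul_self (hYpos (t + 1) s)
    have e0 : (fun s => (factor (leading (G.n t) (Y t) s))ᵀ *
        factor (leading (G.n t) (Y t) s)) = leading (G.n t) (Y t) :=
      funext fun s => factor_transpose_mul_self (hYpos t s)
    have h3 : w ⬝ᵥ w = v ⬝ᵥ (diagIn (leading (G.n t) (Y t)) k *ᵥ v) := by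
      rw [← e0, ← dotProduct_diagIn_mulVec_self, ← h2]
    rw [h1, dotProduct_diagOut_mulVec_self, e1, h3]
    have h4 := hL t k v
    have h5 : v ⬝ᵥ (diagIn (leading (G.n t) (Y t)) k *ᵥ v) ≤ b * (v ⬝ᵥ v) := by
      rw [← dotProduct_smul_one_mulVec, ← diagIn_smul_one]
      refine dotProduct_diagIn_mulVec_mono (fun s x => ?_) k v
      rw [dotProduct_smul_one_mulVec]
      exact (hYb t s x).trans
        (mul_le_mul_of_nonneg_right (le_max_left _ _) (dotProduct_self_nonneg x))
    have h6 : ε / b * (v ⬝ᵥ (diagIn (leading (G.n t) (Y t)) k *ᵥ v)) ≤ ε * (v ⬝ᵥ v) := by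
      rw [div_mul_eq_mul_div, div_le_iff₀ hb0]
      nlinarith
    linarith

/-- A uniformly contractive eventually time-periodic realization is balanced, with a multiple of
the identity as balanced generalized gramian. -/
theorem IsETP.exists_isBalancedBy {h q : ℕ} (hq : 0 < q) (hG : G.IsETP h q) {δ : ℝ} (hδ : 0 < δ)
    (hδ1 : δ < 1)
    (hA : ∀ t k v, (G.A t k *ᵥ v) ⬝ᵥ (G.A t k *ᵥ v) ≤ (1 - δ) * (v ⬝ᵥ v)) :
    ∃ c : ℝ, G.IsBalancedBy fun t s => c • (1 : Matrix (Fin (G.n t s)) (Fin (G.n t s)) ℝ) := by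
  have key : ∀ a b : (Σ d : (Slot E → ℕ) × (Slot E → ℕ) × (V → ℕ) × (V → ℕ),
      (∀ k, Matrix (OutIdx d.1 k) (InIdx d.2.1 k) ℝ) ×
      (∀ k, Matrix (OutIdx d.1 k) (Fin (d.2.2.1 k)) ℝ) ×
      (∀ k, Matrix (Fin (d.2.2.2 k)) (InIdx d.2.1 k) ℝ) ×
      (∀ k, Matrix (Fin (d.2.2.2 k)) (Fin (d.2.2.1 k)) ℝ)), a = b →
      ∑ k, ∑ i, ∑ j, (a.2.2.1 k)ᵀ i j ^ 2 = ∑ k, ∑ i, ∑ j, (b.2.2.1 k)ᵀ i j ^ 2 ∧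
      ∑ k, ∑ i, ∑ j, a.2.2.2.1 k i j ^ 2 = ∑ k, ∑ i, ∑ j, b.2.2.2.1 k i j ^ 2 := by
    rintro a b rfl
    exact ⟨rfl, rfl⟩
  have hEB : DistSys.IsETP h q fun t => ∑ k, ∑ i, ∑ j, (G.B t k)ᵀ i j ^ 2 := fun t z =>
    (key _ _ (hG t z)).1
  have hEC : DistSys.IsETP h q fun t => ∑ k, ∑ i, ∑ j, G.C t k i j ^ 2 := fun t z =>
    (key _ _ (hG t z)).2
  obtain ⟨b₁, hb₁⟩ := hEB.exists_le hq
  obtain ⟨b₂, hb₂⟩ := hEC.exists_le hq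
  -- A common bound for the squared Frobenius norms of all `B` and `C`, finite by periodicity. The
  -- maximum with `0`, together with `δ < 1`, gives `c ≥ 1`, which exceeds the margin `1 / 2` used
  -- below.
  set b := max (max b₁ b₂) 0 with hb
  have hb0 : 0 ≤ b := le_max_right _ _
  have hB : ∀ t k v, ((G.B t k)ᵀ *ᵥ v) ⬝ᵥ ((G.B t k)ᵀ *ᵥ v) ≤ b * (v ⬝ᵥ v) := fun t k v => by
    refine (dotProduct_mulVec_self_le _ v).trans
      (mul_le_mul_of_nonneg_right ?_ (dotProduct_self_nonneg v))
    refine le_trans ?_ ((hb₁ t).trans ((le_max_left _ _).trans (le_max_left _ _)))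
    exact Finset.single_le_sum (f := fun k => ∑ i, ∑ j, (G.B t k)ᵀ i j ^ 2)
      (fun k _ => by positivity) (Finset.mem_univ k)
  have hC : ∀ t k v, (G.C t k *ᵥ v) ⬝ᵥ (G.C t k *ᵥ v) ≤ b * (v ⬝ᵥ v) := fun t k v => by
    refine (dotProduct_mulVec_self_le _ v).trans
      (mul_le_mul_of_nonneg_right ?_ (dotProduct_self_nonneg v))
    refine le_trans ?_ ((hb₂ t).trans ((le_max_right _ _).trans (le_max_left _ _)))
    exact Finset.single_le_sum (f := fun k => ∑ i, ∑ j, G.C t k i j ^ 2)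
      (fun k _ => by positivity) (Finset.mem_univ k)
  set c := (b + 1) / δ with hc
  have hcδ : c * δ = b + 1 := div_mul_cancel₀ _ hδ.ne'
  have hc1 : 1 ≤ c := by
    rw [hc, le_div_iff₀ hδ]
    linarith
  have hslt : ∀ (x y : ℝ) (d : ℕ), x < y →
      SLt (x • (1 : Matrix (Fin d) (Fin d) ℝ)) (y • 1) := fun x y d hxy => by
    rw [SLt, ← sub_smul]
    exact Matrix.PosDef.one.smul (sub_pos.2 hxy)
  refine ⟨c, fun t s => ?_, 1 / 2, by norm_num, ⟨fun t s => hslt _ _ _ (by linarith), c + 1,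
    fun t s => hslt _ _ _ (by linarith)⟩, fun t k => ?_, fun t k => ?_⟩
  · exact Matrix.isDiag_one.smul c
  · rw [diagIn_smul_one, diagOut_smul_one]
    exact slt_lyapunov_smul_one (A := (G.A t k)ᵀ) (B := (G.B t k)ᵀ)
      (dotProduct_transpose_mulVec_le (by linarith) (hA t k)) (hB t k) (by linarith) hcδ
  · rw [diagIn_smul_one, diagOut_smul_one]
    exact slt_lyapunov_smul_one (hA t k) (hC t k) (by linarith) hcδ

end Sys

end

end DistSys

theorem mainTheorem4 {V : Type*} [Fintype V] [DecidableEq V] (E : Finset (V × V))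
    (nu ny : ℕ → V → ℕ) (G : DistSys.Sys E nu ny) (h q : ℕ) (hq : 0 < q)
    (hG : G.IsETP h q) (hstable : G.StronglyStable) :
    -- an ETP balanced realization with ETP gramians, ordered decreasingly, exists
    (∃ T : DistSys.Family G.n, (∀ t s, IsUnit (T t s)) ∧ T.IsETP h q ∧
      (G.transform T).IsETP h q ∧ (∀ u, (G.transform T).output u = G.output u) ∧
      ∃ S : DistSys.Family G.n, S.IsETP h q ∧ (G.transform T).IsBalancedBy S ∧
        ∀ t s, Antitone fun i => S t s i i) ∧
    -- balanced truncation of any such realization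
    (∀ Gb : DistSys.Sys E nu ny, Gb.IsETP h q → (∀ u, Gb.output u = G.output u) →
      ∀ S : DistSys.Family Gb.n, S.IsETP h q → Gb.IsBalancedBy S →
      ∀ (r : ℕ → DistSys.Slot E → ℕ) (hr : ∀ t s, r t s ≤ Gb.n t s), DistSys.IsETP h q r →
        (Gb.truncate r hr).IsETP h q ∧ (Gb.truncate r hr).StronglyStable ∧
        (S.kept r hr).IsETP h q ∧ (Gb.truncate r hr).IsBalancedBy (S.kept r hr) ∧
        ((∃ t s, r t s < Gb.n t s) →
          DistSys.inducedNorm (fun u => G.output u - (Gb.truncate r hr).output u) <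
            ENNReal.ofReal (2 * DistSys.zeta ((S.cut r).diagUpTo (h + q))))) := by
  refine ⟨?_, fun Gb hGb hout S hS hbal r hr hrE => ⟨hGb.truncate hr hrE,
    (hbal.truncate r hr).stronglyStable, hS.kept hr hrE, hbal.truncate r hr, fun hlt => ?_⟩⟩
  · obtain ⟨T, hT, hTE, hGT, δ, hδ, hδ1, hA⟩ := hG.exists_transform_contractive hq hstable
    obtain ⟨c, hc⟩ := hGT.exists_isBalancedBy hq hδ hδ1 hA
    refine ⟨T, hT, hTE, hGT, DistSys.Sys.output_transform hT, _, fun t z => ?_, hc,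
      fun t s i j _ => ?_⟩
    · exact congrArg (fun d : DistSys.Slot E → ℕ =>
        (⟨d, fun s => c • (1 : Matrix (Fin (d s)) (Fin (d s)) ℝ)⟩ :
          Σ d : DistSys.Slot E → ℕ, ∀ s, Matrix (Fin (d s)) (Fin (d s)) ℝ)) (hG.dim t z)
    -- The gramians are multiples of the identity, so their diagonals are constant and the ordering
    -- is automatic.
    · have e : ∀ i : Fin (G.n t s),
          (c • (1 : Matrix (Fin (G.n t s)) (Fin (G.n t s)) ℝ)) i i = c := fun i => by simp
      exact ((e j).trans (e i).symm).le
  · simp only [← hout]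
    exact hbal.inducedNorm_truncate_lt hq hS r hr hrE hlt
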